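/- Let $(\Omega,\Sigma,\mu)$ be a nonatomic $\sigma$-finite measure space and let $P\colon\Omega\to(0,\infty]$ be measurable. Let $R(P)\subseteq[0,\infty]$ be its essential range, that is, the support of the image measure $P(\mu)$, and suppose that $P^-:=\min R(P)>0$. Let $\mathbb{F}$ be the real or complex field. Put $\Phi_p(t)=t^p$ for $0<p<\infty$ and $\Phi_\infty=\infty\,\chi_{(1,\infty)}$. The space $L_P$ consists of all (classes of) measurable $f\colon\Omega\to\mathbb{F}$ with $\int_\Omega \Phi_{P(\omega)}(t|f(\omega)|)\,d\mu(\omega)<\infty$ for some $t\in(0,\infty)$, with the quasi-norm $\|f\|_P=\inf\{t>0 : \int_\Omega\Phi_{P(\omega)}(|f(\omega)|/t)\,d\mu(\omega)<1\}$. An Orlicz function is a non-decreasing left-continuous function $F\colon[0,\infty)\to[0,\infty]$ with $\lim_{t\to0^+}F(t)=0$ and $\lim_{t\to\infty}F(t)>0$. The Orlicz sequence space $\ell_F$ consists of all $a\in\mathbb{F}^{\mathbb{N}}$ with $\sum_n F(t|a_n|)<\infty$ for some $t\in(0,\infty)$, with the vector topology for which the sets $\{a : \sum_n F(|a_n|/u)<\varepsilon\}$,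 $u,\varepsilon\in(0,\infty)$, form a neighbourhood basis at $0$. For nonempty $R\subseteq(0,\infty]$ let $\mathcal{K}(R)$ be the closed convex hull in $C([0,1])$ of $\{\psi_p : p\in R\}$, where $\psi_p(t)=t^p/p$ for $p<\infty$ and $\psi_\infty=0$. Let $\mathcal{O}(R)$ be the set of all Orlicz functions $F$ for which there are $0<c\le1$, $\varphi\in\mathcal{K}(R)$ and constants $A,B\in(0,\infty)$ with $A\varphi(t)\le F(t)\le B\varphi(t)$ for $0\le t\le c$. A sequence space is a quasi-Banach lattice $\mathbb{S}\subseteq\mathbb{F}^{\mathbb{N}}$ (if $f\in\mathbb{S}$ and $|g|\le|f|$, then $g\in\mathbb{S}$ and $\|g\|\le\|f\|$) whose coordinate functionals are continuous, which contains the unit vectors $e_n$, and for which there is a constant $C$ such that, whenever $f_k\in\mathbb{S}$ converge coordinatewise to $f$ and $s:=\limsup_k\|f_k\|<\infty$, we have $f\in\mathbb{S}$ and $\|f\|\le Cs$. It is subsymmetric if, for every strictly increasing $\pi\colon\mathbb{N}\to\mathbb{N}$, the map $(a_n)_n\mapsto(a_{\pi(n)})_n$ is an isometry from $\{f\in\mathbb{S}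 : \operatorname{supp} f\subseteq\pi(\mathbb{N})\}$ onto $\mathbb{S}$. It disjointly embeds into $L_P$ if there is a linear map $T\colon\mathbb{S}\to L_P$ that is an isomorphism onto its image (as a map between quasi-normed spaces) and for which the functions $T(e_n)$, $n\in\mathbb{N}$, are pairwise disjointly supported up to null sets. Let $\mathbb{S}$ be a subsymmetric sequence space. Then the following are equivalent: 1. $\mathbb{S}$ disjointly embeds into $L_P$; 2. $\mathbb{S}=\ell_F$, with the same topology, for some $F\in\mathcal{O}(R(P))$. -/

import Mathlib

open MeasureTheory Filter Topology
open scoped NNReal ENNReal unitInterval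

namespace VarExp

/-! ### Musielak-Orlicz spaces -/

/-- An Orlicz function: a non-decreasing left-continuous `F : [0,∞) → [0,∞]` with
`F(t) → 0` as `t → 0⁺` and `lim_{t → ∞} F(t) > 0`. The value `∞` is allowed. -/
structure IsOrlicz (F : ℝ≥0 → ℝ≥0∞) : Prop where
  mono : Monotone F
  left_cont : ∀ t, ContinuousWithinAt F (Set.Iic t) t
  tendsto_zero : Tendsto F (𝓝[>] 0) (𝓝 0)
  top_pos : ∃ L : ℝ≥0∞, 0 < L ∧ Tendsto F atTop (𝓝 L)

section MusielakOrlicz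

variable {Ω : Type*} [MeasurableSpace Ω]

/-- The modular `ρ_M(f) = ∫ M(ω, f(ω)) dμ(ω)`. -/
noncomputable def modular (M : Ω → ℝ≥0 → ℝ≥0∞) (μ : Measure Ω) (f : Ω → ℝ≥0) : ℝ≥0∞ :=
  ∫⁻ ω, M ω (f ω) ∂μ

/-- `f ∈ L_M` (for a measurable `f`): `ρ_M(t|f|) < ∞` for some `t ∈ (0,∞)`. -/
def MemMO {𝕜 : Type*} [RCLike 𝕜] (M : Ω → ℝ≥0 → ℝ≥0∞) (μ : Measure Ω) (f : Ω → 𝕜) : Prop :=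
  ∃ t : ℝ≥0, 0 < t ∧ modular M μ (fun ω => t * ‖f ω‖₊) < ∞

/-- The Luxemburg gauge `inf {t ∈ (0,∞) : ρ_M(|f|/t) < 1}`. -/
noncomputable def luxemburg {𝕜 : Type*} [RCLike 𝕜] (M : Ω → ℝ≥0 → ℝ≥0∞) (μ : Measure Ω)
    (f : Ω → 𝕜) : ℝ≥0∞ :=
  ⨅ (t : ℝ≥0) (_ : 0 < t) (_ : modular M μ (fun ω => ‖f ω‖₊ / t) < 1), (t : ℝ≥0∞)

end MusielakOrlicz

/-! ### Variable exponents -/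

/-- The power function `Φ_p(t) = t^p`, `p ∈ (0,∞]`, where `Φ_∞ = ∞ · χ_{(1,∞)}`. -/
noncomputable def powerFn (p : ℝ≥0∞) (t : ℝ≥0) : ℝ≥0∞ :=
  if p = ∞ then (if t ≤ 1 then 0 else ∞) else (t : ℝ≥0∞) ^ p.toReal

section Exponent

variable {Ω : Type*} [MeasurableSpace Ω]

/-- A variable exponent: a measurable function `P : Ω → (0,∞]`. -/
def IsVarExponent (P : Ω → ℝ≥0∞) : Prop := Measurable P ∧ ∀ ω, 0 < P ω

/-- The Musielak-Orlicz function `M_P(ω,t) = Φ_{P(ω)}(t)`; `L_P` is the space built from it. -/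
noncomputable def expMO (P : Ω → ℝ≥0∞) (ω : Ω) (t : ℝ≥0) : ℝ≥0∞ := powerFn (P ω) t

/-- The essential range `R(P) ⊆ [0,∞]`: the support of the image measure `P(μ)`. -/
noncomputable def essRange (P : Ω → ℝ≥0∞) (μ : Measure Ω) : Set ℝ≥0∞ := (μ.map P).support

/-- `P⁻ = min R(P)`. -/
noncomputable def expMinus (P : Ω → ℝ≥0∞) (μ : Measure Ω) : ℝ≥0∞ := sInf (essRange P μ)

/-- A nonatomic measure: every measurable set of positive measure has a measurable subset of
strictly smaller positive measure. -/
def IsNonatomic (μ : Measure Ω) : Prop :=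
  ∀ A, MeasurableSet A → 0 < μ A → ∃ B, B ⊆ A ∧ MeasurableSet B ∧ 0 < μ B ∧ μ B < μ A

end Exponent

/-! ### Orlicz functions generated near zero by power functions -/

/-- `ψ_p ∈ C([0,1])`, `ψ_p(t) = t^p / p` for `0 < p < ∞`, and `ψ_∞ = 0`. -/
noncomputable def psi (p : ℝ≥0∞) : C(I, ℝ) where
  toFun t := if p = ∞ then 0 else (t : ℝ) ^ p.toReal / p.toReal
  continuous_toFun := by
    by_cases h : p = ∞
    · simp only [h, if_true]; exact continuous_const
    · simp only [h, if_false]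
      exact ((Real.continuous_rpow_const ENNReal.toReal_nonneg).comp
        continuous_subtype_val).div_const _

/-- `𝒦(R)`: the closed convex hull in `C([0,1])` of `{ψ_p : p ∈ R}`. -/
noncomputable def convexPowers (R : Set ℝ≥0∞) : Set C(I, ℝ) :=
  closure (convexHull ℝ (psi '' R))

/-- `F ∈ 𝒪(R)`: `F` is an Orlicz function, and there are `0 < c ≤ 1` and `φ ∈ 𝒦(R)` such that
`F(t) ≈ φ(t)` for `0 ≤ t ≤ c`, that is, `A φ(t) ≤ F(t) ≤ B φ(t)` for some constants
`A, B ∈ (0,∞)`. -/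
def OrliczGen (R : Set ℝ≥0∞) (F : ℝ≥0 → ℝ≥0∞) : Prop :=
  IsOrlicz F ∧ ∃ c : ℝ, 0 < c ∧ c ≤ 1 ∧ ∃ φ ∈ convexPowers R,
    ∃ A B : ℝ, 0 < A ∧ 0 < B ∧ ∀ t : I, (t : ℝ) ≤ c →
      ENNReal.ofReal (A * φ t) ≤ F (unitInterval.toNNReal t) ∧
      F (unitInterval.toNNReal t) ≤ ENNReal.ofReal (B * φ t)

/-! ### Sequence spaces -/

/-- A sequence space, that is, a function space over `ℕ` with the counting measure: a
quasi-Banach lattice of scalar sequences that embeds continuously into the space of all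
sequences (where convergence in measure on finite sets is coordinatewise convergence), contains
all finitely supported sequences, and satisfies a weak Fatou property. -/
structure SequenceSpace (𝕜 : Type*) [RCLike 𝕜] where
  carrier : Submodule 𝕜 (ℕ → 𝕜)
  /-- the quasi-norm -/
  nrm : carrier → ℝ≥0
  nrm_eq_zero : ∀ f, nrm f = 0 → f = 0
  nrm_smul : ∀ (a : 𝕜) (f : carrier), nrm (a • f) = ‖a‖₊ * nrm f
  nrm_add : ∃ κ : ℝ≥0, ∀ f g, nrm (f + g) ≤ κ * (nrm f + nrm g)
  complete : ∀ u : ℕ → carrier,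
    (∀ ε : ℝ≥0, 0 < ε → ∃ K, ∀ j ≥ K, ∀ k ≥ K, nrm (u j - u k) < ε) →
    ∃ f, Tendsto (fun k => nrm (u k - f)) atTop (𝓝 0)
  lattice : ∀ (f : carrier) (g : ℕ → 𝕜), (∀ n, ‖g n‖ ≤ ‖(f : ℕ → 𝕜) n‖) →
    ∃ hg : g ∈ carrier, nrm ⟨g, hg⟩ ≤ nrm f
  coord_cont : ∀ n, ∃ C : ℝ≥0, ∀ f : carrier, ‖(f : ℕ → 𝕜) n‖₊ ≤ C * nrm f
  single_mem : ∀ n, (Pi.single n 1 : ℕ → 𝕜) ∈ carrier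
  fatou : ∃ C : ℝ≥0, ∀ (u : ℕ → carrier) (g : ℕ → 𝕜),
    (∀ n, Tendsto (fun k => (u k : ℕ → 𝕜) n) atTop (𝓝 (g n))) →
    limsup (fun k => (nrm (u k) : ℝ≥0∞)) atTop < ∞ →
    ∃ hg : g ∈ carrier,
      (nrm ⟨g, hg⟩ : ℝ≥0∞) ≤ C * limsup (fun k => (nrm (u k) : ℝ≥0∞)) atTop

namespace SequenceSpace

variable {𝕜 : Type*} [RCLike 𝕜]

/-- The unit vectors `e_n`. -/
noncomputable def unitVec (S : SequenceSpace 𝕜) (n : ℕ) : S.carrier :=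
  ⟨Pi.single n 1, S.single_mem n⟩

/-- `S` is subsymmetric: for every (strictly) increasing `π : ℕ → ℕ`, the map
`(a_n) ↦ (a_{π(n)})` is an isometry from `{f ∈ S : supp f ⊆ π(ℕ)}` onto `S`. -/
def IsSubsymmetric (S : SequenceSpace 𝕜) : Prop :=
  ∀ π : ℕ → ℕ, StrictMono π →
    (∀ f : S.carrier, Function.support (f : ℕ → 𝕜) ⊆ Set.range π →
      ∃ h : (fun n => (f : ℕ → 𝕜) (π n)) ∈ S.carrier, S.nrm ⟨_, h⟩ = S.nrm f) ∧
    (∀ g : S.carrier, ∃ f : S.carrier, Function.support (f : ℕ → 𝕜) ⊆ Set.range π ∧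
      ∀ n, (f : ℕ → 𝕜) (π n) = (g : ℕ → 𝕜) n)

/-- `S` disjointly embeds into `L_P(μ)`: there is a linear map `T : S → L_P(μ)` that is an
isomorphism onto its image and for which the functions `T(e_n)` are pairwise disjointly
supported. Here `P⁻ > 0`, so the Luxemburg gauge is a quasi-norm inducing the topology of
`L_P(μ)`. -/
def DisjointlyEmbeds (S : SequenceSpace 𝕜) {Ω : Type*} [MeasurableSpace Ω] (μ : Measure Ω)
    (P : Ω → ℝ≥0∞) : Prop :=
  ∃ T : S.carrier →ₗ[𝕜] (Ω →ₘ[μ] 𝕜),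
    (∀ a, MemMO (expMO P) μ (T a)) ∧
    (∃ C : ℝ≥0, ∀ a, luxemburg (expMO P) μ (T a) ≤ C * S.nrm a ∧
      (S.nrm a : ℝ≥0∞) ≤ C * luxemburg (expMO P) μ (T a)) ∧
    ∀ m n, m ≠ n → ∀ᵐ ω ∂μ, T (S.unitVec m) ω = 0 ∨ T (S.unitVec n) ω = 0

/-- `S = ℓ_F` as topological vector spaces: the underlying sets agree, and so do the topology
given by the quasi-norm of `S` and the vector topology of `ℓ_F`, for which the sets
`u B_F(ε) = {a : ρ_F(|a|/u) < ε}`, `u, ε ∈ (0,∞)`, are a neighbourhood basis at the origin. -/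
def EqOrliczSpace (S : SequenceSpace 𝕜) (F : ℝ≥0 → ℝ≥0∞) : Prop :=
  (∀ a : ℕ → 𝕜, a ∈ S.carrier ↔ MemMO (fun _ => F) Measure.count a) ∧
  (∀ u ε : ℝ≥0, 0 < u → 0 < ε → ∃ δ : ℝ≥0, 0 < δ ∧ ∀ a : S.carrier, S.nrm a < δ →
    modular (fun _ => F) Measure.count (fun n => ‖(a : ℕ → 𝕜) n‖₊ / u) < ε) ∧
  (∀ δ : ℝ≥0, 0 < δ → ∃ u ε : ℝ≥0, 0 < u ∧ 0 < ε ∧ ∀ a : S.carrier,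
    modular (fun _ => F) Measure.count (fun n => ‖(a : ℕ → 𝕜) n‖₊ / u) < ε → S.nrm a < δ)

end SequenceSpace

end VarExp

/-! A disjoint embedding of `S` into `L_P(μ)` identifies `S` with the Musielak–Orlicz sequence space
of the functions `G n t = ρ_P(t f_n)`, where `f_n` is the absolute value of the image of `e_n`. Near
zero, `G n` is a multiple of an average of the functions `ψ_p`, with respect to the measure of
density `p e^{-p} Φ_p(b f_n)`, `p = P(ω)`, so up to a factor it is an element of `𝒦(R(P))`. As
`𝒦(R(P))` is compact, some subsequence of these elements converges, even with summable distances, to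
`k ∈ 𝒦(R(P))`. Passing to the subsequence does not change `S`, which is subsymmetric, and a summable
perturbation of the functions does not change the space they define, so `S = ℓ_F` where `F = k` on
`[0,1]`.

Conversely, a nonatomic measure space splits into countably many pieces on each of which `P` still
has the full essential range. Averages of `ψ_P` over the `n`-th piece are dense in `𝒦(R(P))`, and
the average with density `h` is the function `t ↦ ρ_P(t g)` for `g = (h / P)^{1/P}`. Summably small
errors again do no harm, so `ℓ_F` is spanned by such functions `g` on disjoint pieces. -/

namespace VarExp

section Nonatomic

variable {Ω : Type*} [MeasurableSpace Ω] {μ : Measure Ω}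

lemma IsNonatomic.exists_subset_measure_le_half (hμ : IsNonatomic μ) {A : Set Ω}
    (hA : MeasurableSet A) (hpos : 0 < μ A) :
    ∃ B ⊆ A, MeasurableSet B ∧ 0 < μ B ∧ μ B ≤ μ A / 2 := by
  obtain ⟨B, hBA, hB, hBpos, hBlt⟩ := hμ A hA hpos
  rcases le_total (μ B) (μ A / 2) with hle | hge
  · exact ⟨B, hBA, hB, hBpos, hle⟩
  have hdiff : μ (A \ B) = μ A - μ B := measure_sdiff hBA hB.nullMeasurableSet hBlt.ne_top
  refine ⟨A \ B, Set.sdiff_subset, hA.diff hB, hdiff ▸ tsub_pos_of_lt hBlt, ?_⟩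
  rw [hdiff, tsub_le_iff_right]
  calc μ A = μ A / 2 + μ A / 2 := (ENNReal.add_halves _).symm
    _ ≤ μ A / 2 + μ B := by gcongr

lemma IsNonatomic.exists_subset_measure_lt [SigmaFinite μ] (hμ : IsNonatomic μ) {A : Set Ω}
    (hA : MeasurableSet A) (hpos : 0 < μ A) {ε : ℝ≥0∞} (hε : 0 < ε) :
    ∃ B ⊆ A, MeasurableSet B ∧ 0 < μ B ∧ μ B < ε := by
  obtain ⟨A', hA', hsub, hpos', hfin⟩ := Measure.exists_subset_measure_lt_top hA hpos
  have halve : ∀ n : ℕ, ∃ B ⊆ A', MeasurableSet B ∧ 0 < μ B ∧ μ B ≤ μ A' * 2⁻¹ ^ n := by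
    intro n
    induction n with
    | zero => exact ⟨A', subset_rfl, hA', hpos', by simp⟩
    | succ n ih =>
      obtain ⟨B, hBA, hB, hBpos, hBle⟩ := ih
      obtain ⟨C, hCB, hC, hCpos, hCle⟩ := hμ.exists_subset_measure_le_half hB hBpos
      refine ⟨C, hCB.trans hBA, hC, hCpos, hCle.trans ?_⟩
      rw [pow_succ, ← mul_assoc, div_eq_mul_inv]
      gcongr
  have hlim : Tendsto (fun n : ℕ => μ A' * 2⁻¹ ^ n) atTop (𝓝 0) := by
    simpa using ENNReal.Tendsto.const_mul
      (ENNReal.tendsto_pow_atTop_nhds_zero_of_lt_one (r := 2⁻¹) (by simp)) (Or.inr hfin.ne)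
  obtain ⟨n, hn⟩ := (hlim.eventually_lt_const hε).exists
  obtain ⟨B, hBA, hB, hBpos, hBle⟩ := halve n
  exact ⟨B, hBA.trans hsub, hB, hBpos, hBle.trans_lt hn⟩

lemma tsum_tail_le_half {a : ℕ → ℝ≥0∞} (ha : ∀ n, a (n + 1) ≤ a n / 4) (n : ℕ) :
    ∑' j, a (n + 1 + j) ≤ a n / 2 := by
  have h4 : (4 : ℝ≥0∞)⁻¹ = 2⁻¹ * 2⁻¹ := by
    rw [← ENNReal.mul_inv (by simp) (by simp)]
    norm_num
  have hdecay : ∀ j, a (n + 1 + j) ≤ a n / 2 * 2⁻¹ ^ (j + 1) := by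
    intro j
    induction j with
    | zero => simpa [div_eq_mul_inv, h4, mul_assoc] using ha n
    | succ j ih =>
      calc a (n + 1 + (j + 1)) ≤ a (n + 1 + j) / 4 := ha _
        _ = a (n + 1 + j) * (2⁻¹ * 2⁻¹) := by rw [div_eq_mul_inv, h4]
        _ ≤ a n / 2 * 2⁻¹ ^ (j + 1) * (1 * 2⁻¹) := by
          gcongr
          simp
        _ = a n / 2 * 2⁻¹ ^ (j + 1 + 1) := by ring
  calc ∑' j, a (n + 1 + j) ≤ ∑' j, a n / 2 * 2⁻¹ ^ (j + 1) := ENNReal.tsum_le_tsum hdecay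
    _ = a n / 2 := by
      rw [ENNReal.tsum_mul_left, ENNReal.tsum_geometric_add_one, ENNReal.one_sub_inv_two, inv_inv,
        ENNReal.inv_mul_cancel (by simp) (by simp), mul_one]

lemma IsNonatomic.exists_subsets_measure_succ_le [SigmaFinite μ] (hμ : IsNonatomic μ)
    {E : ℕ → Set Ω} (hE : ∀ n, MeasurableSet (E n)) (hpos : ∀ n, 0 < μ (E n)) :
    ∃ B : ℕ → Set Ω, ∀ n, B n ⊆ E n ∧ MeasurableSet (B n) ∧ 0 < μ (B n) ∧ μ (B n) < ∞ ∧
      μ (B (n + 1)) ≤ μ (B n) / 4 := by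
  have hsmall : ∀ n (ε : {ε : ℝ≥0∞ // 0 < ε}),
      ∃ B ⊆ E n, MeasurableSet B ∧ 0 < μ B ∧ μ B < ε :=
    fun n ε => hμ.exists_subset_measure_lt (hE n) (hpos n) ε.2
  choose small hsub hmeas hsmall_pos hsmall_lt using hsmall
  let B : ℕ → {B : Set Ω // 0 < μ B} := fun n =>
    Nat.rec ⟨small 0 ⟨1, one_pos⟩, hsmall_pos _ _⟩
      (fun n B => ⟨small (n + 1) ⟨μ B.1 / 4, ENNReal.div_pos B.2.ne' (by simp)⟩, hsmall_pos _ _⟩) n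
  refine ⟨fun n => (B n).1, fun n => ⟨?_, ?_, (B n).2, ?_, (hsmall_lt (n + 1) _).le⟩⟩
  · cases n <;> exact hsub _ _
  · cases n <;> exact hmeas _ _
  · cases n <;> exact (hsmall_lt _ _).trans_le le_top

lemma IsNonatomic.exists_disjoint_subsets [SigmaFinite μ] (hμ : IsNonatomic μ) {E : ℕ → Set Ω}
    (hE : ∀ n, MeasurableSet (E n)) (hpos : ∀ n, 0 < μ (E n)) :
    ∃ D : ℕ → Set Ω, (∀ n, D n ⊆ E n) ∧ (∀ n, MeasurableSet (D n)) ∧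
      Pairwise (Function.onFun Disjoint D) ∧ ∀ n, 0 < μ (D n) := by
  obtain ⟨B, hB⟩ := hμ.exists_subsets_measure_succ_le hE hpos
  choose hBE hBm hBpos hBfin hBsucc using hB
  have htail : ∀ n, μ (⋃ j, B (n + 1 + j)) < μ (B n) := fun n =>
    calc μ (⋃ j, B (n + 1 + j)) ≤ ∑' j, μ (B (n + 1 + j)) := measure_iUnion_le _
      _ ≤ μ (B n) / 2 := tsum_tail_le_half hBsucc n
      _ < μ (B n) := ENNReal.half_lt_self (hBpos n).ne' (hBfin n).ne
  refine ⟨fun n => B n \ ⋃ j, B (n + 1 + j), fun n => Set.sdiff_subset.trans (hBE n),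
    fun n => (hBm n).diff (MeasurableSet.iUnion fun j => hBm _), ?_,
    fun n => (tsub_pos_of_lt (htail n)).trans_le le_measure_sdiff⟩
  refine (pairwise_disjoint_on _).2 fun k n hkn => Set.disjoint_left.2 fun ω hk hn => hk.2 ?_
  obtain ⟨j, rfl⟩ := Nat.exists_eq_add_of_lt hkn
  exact Set.mem_iUnion.2 ⟨j, add_right_comm k j 1 ▸ hn.1⟩

lemma IsNonatomic.exists_partition_support_subset [SigmaFinite μ] (hμ : IsNonatomic μ)
    {X : Type*} [TopologicalSpace X] [SecondCountableTopology X] [MeasurableSpace X]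
    [OpensMeasurableSpace X] {P : Ω → X} (hP : Measurable P) :
    ∃ N : Ω → ℕ, Measurable N ∧
      ∀ n, (μ.map P).support ⊆ ((μ.restrict (N ⁻¹' {n})).map P).support := by
  have hbasis := TopologicalSpace.isBasis_countableBasis X
  let 𝒱 := {V : TopologicalSpace.countableBasis X // 0 < μ (P ⁻¹' V)}
  have hsub : ∀ x ∈ (μ.map P).support, ∀ U ∈ 𝓝 x, ∃ V : 𝒱, (V.1 : Set X) ⊆ U := by
    intro x hx U hU
    obtain ⟨V, hV, hxV, hVU⟩ := hbasis.mem_nhds_iff.1 hU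
    have hVo := hbasis.isOpen hV
    have hVpos := (Measure.mem_support_iff_forall x).1 hx V (hVo.mem_nhds hxV)
    rw [Measure.map_apply hP hVo.measurableSet] at hVpos
    exact ⟨⟨⟨V, hV⟩, hVpos⟩, hVU⟩
  rcases isEmpty_or_nonempty 𝒱 with hempty | hne
  · exact ⟨fun _ => 0, measurable_const, fun n x hx =>
      hempty.elim (hsub x hx _ univ_mem).choose⟩
  obtain ⟨e, he⟩ := exists_surjective_nat (ℕ × 𝒱)
  obtain ⟨D, hDE, hDm, hDd, hDpos⟩ := hμ.exists_disjoint_subsets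
    (E := fun i => P ⁻¹' (e i).2.1)
    (fun i => hP (hbasis.isOpen (e i).2.1.2).measurableSet) (fun i => (e i).2.2)
  obtain ⟨N, hN, hND⟩ := exists_measurable_piecewise D hDm (fun i _ => (e i).1)
    (fun i => measurable_const) fun i j hij => by
      beta_reduce
      rw [(hDd hij).inter_eq]
      exact Set.eqOn_empty _ _
  refine ⟨N, hN, fun n x hx => (Measure.mem_support_iff_forall x).2 fun U hU => ?_⟩
  obtain ⟨V, hVU⟩ := hsub x hx U hU
  obtain ⟨i, hi⟩ := he (n, V)
  have hDn : D i ⊆ P ⁻¹' U ∩ N ⁻¹' {n} := fun ω hω =>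
    ⟨hVU (by simpa [hi] using hDE i hω), by simpa [hi] using hND i hω⟩
  calc 0 < μ (D i) := hDpos i
    _ ≤ μ (P ⁻¹' U ∩ N ⁻¹' {n}) := measure_mono hDn
    _ = μ.restrict (N ⁻¹' {n}) (P ⁻¹' U) :=
      (Measure.restrict_apply' (hN (measurableSet_singleton n))).symm
    _ ≤ (μ.restrict (N ⁻¹' {n})).map P U := Measure.le_map_apply hP.aemeasurable U

end Nonatomic

section LowerType

variable {m : ℝ≥0} {F : ℝ≥0 → ℝ≥0∞}

/-- `F` has lower type `m`. A positive lower type replaces homogeneity when constants are absorbed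
into dilations. -/
def HasLowerType (m : ℝ≥0) (F : ℝ≥0 → ℝ≥0∞) : Prop :=
  ∀ s t : ℝ≥0, s ≤ 1 → F (s * t) ≤ (s : ℝ≥0∞) ^ (m : ℝ) * F t

lemma HasLowerType.monotone (hF : HasLowerType m F) : Monotone F := by
  intro s t hst
  rcases eq_or_ne t 0 with rfl | ht
  · rw [nonpos_iff_eq_zero.1 hst]
  have hquot : s / t ≤ 1 := div_le_one_of_le₀ hst zero_le
  calc F s = F (s / t * t) := by rw [div_mul_cancel₀ _ ht]
    _ ≤ ((s / t : ℝ≥0) : ℝ≥0∞) ^ (m : ℝ) * F t := hF _ _ hquot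
    _ ≤ F t := mul_le_of_le_one_left'
      (ENNReal.rpow_le_one (ENNReal.coe_le_one_iff.2 hquot) m.coe_nonneg)

lemma HasLowerType.map_zero (hm : 0 < m) (hF : HasLowerType m F) : F 0 = 0 := by
  simpa [hm] using hF 0 0 zero_le_one

lemma tendsto_coe_rpow_mul (hm : 0 < m) {D : ℝ≥0∞} (hD : D ≠ ∞) :
    Tendsto (fun s : ℝ≥0 => (s : ℝ≥0∞) ^ (m : ℝ) * D) (𝓝[>] 0) (𝓝 0) := by
  have hcont : Continuous fun s : ℝ≥0 => (s : ℝ≥0∞) ^ (m : ℝ) :=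
    ENNReal.continuous_rpow_const.comp ENNReal.continuous_coe
  have hpow : Tendsto (fun s : ℝ≥0 => (s : ℝ≥0∞) ^ (m : ℝ)) (𝓝 0) (𝓝 0) := by
    simpa [hm] using hcont.tendsto 0
  simpa using (ENNReal.Tendsto.mul_const hpow (Or.inr hD)).mono_left nhdsWithin_le_nhds

lemma eventually_le_one_nhdsGT_zero : ∀ᶠ s : ℝ≥0 in 𝓝[>] 0, s ≤ 1 :=
  nhdsWithin_le_nhds (Iic_mem_nhds zero_lt_one)

lemma exists_coe_rpow_mul_lt (hm : 0 < m) {D ε : ℝ≥0∞} (hD : D ≠ ∞) (hε : 0 < ε) :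
    ∃ s : ℝ≥0, 0 < s ∧ s ≤ 1 ∧ (s : ℝ≥0∞) ^ (m : ℝ) * D < ε := by
  obtain ⟨s, ⟨hs0, hs1⟩, hs⟩ := ((eventually_mem_nhdsWithin.and
    eventually_le_one_nhdsGT_zero).and ((tendsto_coe_rpow_mul hm hD).eventually_lt_const hε)).exists
  exact ⟨s, hs0, hs1, hs⟩

lemma HasLowerType.tendsto_zero (hm : 0 < m) (hF : HasLowerType m F) (hF1 : F 1 ≠ ∞) :
    Tendsto F (𝓝[>] 0) (𝓝 0) := by
  refine tendsto_of_tendsto_of_tendsto_of_le_of_le' tendsto_const_nhds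
    (tendsto_coe_rpow_mul hm hF1) (Eventually.of_forall fun _ => zero_le) ?_
  filter_upwards [eventually_le_one_nhdsGT_zero] with s hs
  simpa using hF s 1 hs

end LowerType

section Modular

variable {Ω : Type*} [MeasurableSpace Ω] {M : Ω → ℝ≥0 → ℝ≥0∞} {μ : Measure Ω} {m : ℝ≥0}

lemma modular_count (G : ℕ → ℝ≥0 → ℝ≥0∞) (x : ℕ → ℝ≥0) :
    modular G Measure.count x = ∑' n, G n (x n) :=
  lintegral_count _

lemma modular_mul_le (hM : ∀ᵐ ω ∂μ, HasLowerType m (M ω)) {s : ℝ≥0} (hs : s ≤ 1) (x : Ω → ℝ≥0) :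
    modular M μ (fun ω => s * x ω) ≤ (s : ℝ≥0∞) ^ (m : ℝ) * modular M μ x := by
  rw [modular, modular, ← lintegral_const_mul' _ _
    (ENNReal.rpow_ne_top_of_nonneg m.coe_nonneg ENNReal.coe_ne_top)]
  exact lintegral_mono_ae (hM.mono fun ω hω => hω s (x ω) hs)

lemma modular_mono (hM : ∀ᵐ ω ∂μ, Monotone (M ω)) {x y : Ω → ℝ≥0} (hxy : ∀ ω, x ω ≤ y ω) :
    modular M μ x ≤ modular M μ y :=
  lintegral_mono_ae (hM.mono fun ω hω => hω (hxy ω))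

/-- `t ↦ ρ_M(t f)`. When `f_n` are disjointly supported, `ρ_M(∑ x_n f_n)` is the sum of these
functions evaluated at `x_n`, so they describe the sequence space spanned by `f_n`. -/
noncomputable def modularDilation (M : Ω → ℝ≥0 → ℝ≥0∞) (μ : Measure Ω) (f : Ω → ℝ≥0)
    (t : ℝ≥0) : ℝ≥0∞ :=
  modular M μ fun ω => t * f ω

lemma hasLowerType_modularDilation (hM : ∀ᵐ ω ∂μ, HasLowerType m (M ω)) (f : Ω → ℝ≥0) :
    HasLowerType m (modularDilation M μ f) := fun s t hs => by
  simpa only [modularDilation, mul_assoc] using modular_mul_le hM hs fun ω => t * f ω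

lemma le_coe_mul_of_forall_lt {C : ℝ≥0} (hC : 0 < C) {r x : ℝ≥0∞}
    (h : ∀ t : ℝ≥0, r < t → x ≤ C * t) : x ≤ C * r := by
  have hC0 : (C : ℝ≥0∞) ≠ 0 := ENNReal.coe_ne_zero.2 hC.ne'
  rw [mul_comm, ← ENNReal.div_le_iff hC0 ENNReal.coe_ne_top]
  refine le_of_forall_gt_imp_ge_of_dense fun u hu => ?_
  obtain ⟨t, hrt, htu⟩ := ENNReal.lt_iff_exists_nnreal_btwn.1 hu
  rw [ENNReal.div_le_iff hC0 ENNReal.coe_ne_top, mul_comm]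
  exact (h t hrt).trans (by gcongr)

variable {𝕜 : Type*} [RCLike 𝕜] {f : Ω → 𝕜}

lemma luxemburg_le {t : ℝ≥0} (ht : 0 < t) (h : modular M μ (fun ω => ‖f ω‖₊ / t) < 1) :
    luxemburg M μ f ≤ t :=
  iInf_le_of_le t (iInf₂_le ht h)

lemma luxemburg_lt_iff {r : ℝ≥0∞} : luxemburg M μ f < r ↔
    ∃ t : ℝ≥0, 0 < t ∧ modular M μ (fun ω => ‖f ω‖₊ / t) < 1 ∧ (t : ℝ≥0∞) < r := by
  simp only [luxemburg, iInf_lt_iff, exists_prop]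

lemma modular_lt_one_of_luxemburg_lt (hM : ∀ᵐ ω ∂μ, Monotone (M ω)) {t : ℝ≥0}
    (h : luxemburg M μ f < t) : modular M μ (fun ω => ‖f ω‖₊ / t) < 1 := by
  obtain ⟨s, hs, hlt, hst⟩ := luxemburg_lt_iff.1 h
  rw [ENNReal.coe_lt_coe] at hst
  exact (modular_mono hM fun ω => by gcongr).trans_lt hlt

lemma luxemburg_le_mul {C : ℝ≥0} (hC : 0 < C) {r : ℝ≥0∞}
    (h : ∀ t : ℝ≥0, r < t → modular M μ (fun ω => ‖f ω‖₊ / (C * t)) < 1) :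
    luxemburg M μ f ≤ C * r :=
  le_coe_mul_of_forall_lt hC fun t hrt => by
    have ht : 0 < t := ENNReal.coe_pos.1 (zero_le.trans_lt hrt)
    exact_mod_cast luxemburg_le (mul_pos hC ht) (h t hrt)

lemma exists_luxemburg_le_mul (𝕜 : Type*) [RCLike 𝕜] (hm : 0 < m)
    (hM : ∀ᵐ ω ∂μ, HasLowerType m (M ω)) {c : ℝ≥0} (hc : 0 < c) {D : ℝ≥0∞} (hD : D ≠ ∞) :
    ∃ C : ℝ≥0, ∀ (f : Ω → 𝕜) (r : ℝ≥0∞),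
      (∀ t : ℝ≥0, r < t → modular M μ (fun ω => c * (‖f ω‖₊ / t)) ≤ D) →
      luxemburg M μ f ≤ C * r := by
  obtain ⟨s, hs0, hs1, hs⟩ := exists_coe_rpow_mul_lt hm hD one_pos
  refine ⟨(s * c)⁻¹, fun f r h => luxemburg_le_mul (by positivity) fun t ht => ?_⟩
  have hscale : ∀ ω, ‖f ω‖₊ / ((s * c)⁻¹ * t) = s * (c * (‖f ω‖₊ / t)) := fun ω => by
    rw [div_mul_eq_div_div, div_inv_eq_mul]
    ring
  simp_rw [hscale]
  calc modular M μ (fun ω => s * (c * (‖f ω‖₊ / t)))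
      ≤ (s : ℝ≥0∞) ^ (m : ℝ) * modular M μ fun ω => c * (‖f ω‖₊ / t) := modular_mul_le hM hs1 _
    _ ≤ (s : ℝ≥0∞) ^ (m : ℝ) * D := by gcongr; exact h t ht
    _ < 1 := hs

lemma memMO_iff_luxemburg_lt_top (hm : 0 < m) (hM : ∀ᵐ ω ∂μ, HasLowerType m (M ω)) :
    MemMO M μ f ↔ luxemburg M μ f < ∞ := by
  constructor
  · rintro ⟨t, ht, hfin⟩
    obtain ⟨s, hs0, hs1, hs⟩ := exists_coe_rpow_mul_lt hm hfin.ne one_pos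
    refine (luxemburg_le (t := (s * t)⁻¹) (by positivity) ?_).trans_lt ENNReal.coe_lt_top
    simp_rw [div_inv_eq_mul, mul_comm _ (s * t), mul_assoc]
    exact (modular_mul_le hM hs1 _).trans_lt hs
  · intro hfin
    obtain ⟨t, ht, hlt, -⟩ := luxemburg_lt_iff.1 hfin
    refine ⟨t⁻¹, inv_pos.2 ht, ?_⟩
    simp_rw [← div_eq_inv_mul]
    exact hlt.trans ENNReal.one_lt_top

end Modular

section Powers

variable {p q : ℝ≥0∞} {m : ℝ≥0}

lemma powerFn_top (t : ℝ≥0) : powerFn ∞ t = if t ≤ 1 then 0 else ∞ := by simp [powerFn]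

lemma powerFn_of_ne_top (hp : p ≠ ∞) (t : ℝ≥0) :
    powerFn p t = (t : ℝ≥0∞) ^ p.toReal := by simp [powerFn, hp]

lemma powerFn_zero (hp : 0 < p) : powerFn p 0 = 0 := by
  by_cases h : p = ∞
  · simp [h, powerFn_top]
  · simp [powerFn_of_ne_top h, ENNReal.toReal_pos hp.ne' h]

lemma hasLowerType_powerFn (hp : m ≤ p) : HasLowerType m (powerFn p) := by
  intro s t hs
  by_cases h : p = ∞
  · subst h
    rcases le_or_gt (s * t) 1 with hst | hst
    · simp [powerFn_top, hst]
    · have hs0 : s ≠ 0 := by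
        rintro rfl
        simp at hst
      have ht : 1 < t := hst.trans_le (mul_le_of_le_one_left' hs)
      simp [powerFn_top, ht.not_ge, ENNReal.mul_top, hs0]
  · rw [powerFn_of_ne_top h, powerFn_of_ne_top h, ENNReal.coe_mul,
      ENNReal.mul_rpow_of_nonneg _ _ ENNReal.toReal_nonneg]
    exact mul_le_mul_left (ENNReal.rpow_le_rpow_of_exponent_ge (ENNReal.coe_le_one_iff.2 hs)
      (ENNReal.toReal_mono h hp)) _

lemma measurable_powerFn {α : Type*} [MeasurableSpace α] {P : α → ℝ≥0∞} {f : α → ℝ≥0}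
    (hP : Measurable P) (hf : Measurable f) : Measurable fun ω => powerFn (P ω) (f ω) := by
  unfold powerFn
  refine Measurable.ite (hP (measurableSet_singleton _)) ?_ ?_
  · exact Measurable.ite (measurableSet_le hf measurable_const) measurable_const measurable_const
  · exact hf.coe_nnreal_ennreal.pow hP.ennreal_toReal

lemma psi_top : psi ∞ = 0 := by
  ext
  simp [psi]

lemma psi_of_ne_top (hp : p ≠ ∞) (t : I) : psi p t = (t : ℝ) ^ p.toReal / p.toReal := by
  simp [psi, hp]

lemma psi_nonneg (p : ℝ≥0∞) (t : I) : 0 ≤ psi p t := by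
  by_cases hp : p = ∞
  · simp [hp, psi_top]
  · rw [psi_of_ne_top hp]
    exact div_nonneg (Real.rpow_nonneg t.2.1 _) ENNReal.toReal_nonneg

lemma psi_mul_le (hp : m ≤ p) (s t : I) : psi p (s * t) ≤ (s : ℝ) ^ (m : ℝ) * psi p t := by
  by_cases h : p = ∞
  · simp [h, psi_top]
  · rw [psi_of_ne_top h, psi_of_ne_top h, Set.Icc.coe_mul, Real.mul_rpow s.2.1 t.2.1,
      mul_div_assoc]
    exact mul_le_mul_of_nonneg_right
      (Real.rpow_le_rpow_of_exponent_ge' s.2.1 s.2.2 m.coe_nonneg (ENNReal.toReal_mono h hp))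
      (div_nonneg (Real.rpow_nonneg t.2.1 _) ENNReal.toReal_nonneg)

lemma abs_rpow_div_sub_rpow_div_le {t p q : ℝ} (ht0 : 0 ≤ t) (ht1 : t ≤ 1) (hp : 0 < p)
    (hpq : p ≤ q) : |t ^ p / p - t ^ q / q| ≤ p⁻¹ - q⁻¹ := by
  have hq : 0 < q := hp.trans_le hpq
  have hdecr : t ^ q / q ≤ t ^ p / p :=
    div_le_div₀ (Real.rpow_nonneg ht0 _)
      (Real.rpow_le_rpow_of_exponent_ge' ht0 ht1 hp.le hpq) hp hpq
  have hbernoulli : 1 + q / p * (t ^ p - 1) ≤ t ^ q := by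
    have h := one_add_mul_self_le_rpow_one_add (s := t ^ p - 1)
      (by linarith [Real.rpow_nonneg ht0 p]) (p := q / p) ((one_le_div hp).2 hpq)
    rwa [add_sub_cancel, ← Real.rpow_mul ht0, mul_div_cancel₀ _ hp.ne'] at h
  have hdiv : (1 + q / p * (t ^ p - 1)) / q ≤ t ^ q / q := by gcongr
  have hexpand : (1 + q / p * (t ^ p - 1)) / q = q⁻¹ + (t ^ p / p - p⁻¹) := by field_simp
  rw [abs_of_nonneg (by linarith)]
  linarith

lemma norm_psi_sub_le_of_le (hp : 0 < p) (hpq : p ≤ q) :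
    ‖psi p - psi q‖ ≤ p⁻¹.toReal - q⁻¹.toReal := by
  have hinv : q⁻¹.toReal ≤ p⁻¹.toReal :=
    ENNReal.toReal_mono (ENNReal.inv_ne_top.2 hp.ne') (ENNReal.inv_le_inv.2 hpq)
  rw [ContinuousMap.norm_le _ (by linarith)]
  intro t
  rw [ContinuousMap.sub_apply, Real.norm_eq_abs, ENNReal.toReal_inv, ENNReal.toReal_inv]
  by_cases hpt : p = ∞
  · have hqt : q = ∞ := top_le_iff.1 (hpt ▸ hpq)
    simp [hpt, hqt]
  have hp' := ENNReal.toReal_pos hp.ne' hpt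
  by_cases hqt : q = ∞
  · rw [hqt, psi_top, psi_of_ne_top hpt, ContinuousMap.zero_apply, sub_zero, ENNReal.toReal_top,
      inv_zero, sub_zero, abs_of_nonneg (div_nonneg (Real.rpow_nonneg t.2.1 _) hp'.le), ← one_div]
    gcongr
    exact Real.rpow_le_one t.2.1 t.2.2 hp'.le
  · rw [psi_of_ne_top hpt, psi_of_ne_top hqt]
    exact abs_rpow_div_sub_rpow_div_le t.2.1 t.2.2 hp' (ENNReal.toReal_mono hqt hpq)

lemma norm_psi_sub_le (hp : 0 < p) (hq : 0 < q) :
    ‖psi p - psi q‖ ≤ |p⁻¹.toReal - q⁻¹.toReal| := by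
  rcases le_total p q with h | h
  · exact (norm_psi_sub_le_of_le hp h).trans (le_abs_self _)
  · rw [norm_sub_rev, abs_sub_comm]
    exact (norm_psi_sub_le_of_le hq h).trans (le_abs_self _)

lemma lipschitzWith_psi_inv : LipschitzWith 1 fun x : ℝ => psi (ENNReal.ofReal x)⁻¹ := by
  refine LipschitzWith.of_dist_le_mul fun x y => ?_
  rw [NNReal.coe_one, one_mul, dist_eq_norm, Real.dist_eq]
  refine (norm_psi_sub_le (by simp) (by simp)).trans ?_
  rw [inv_inv, inv_inv, ENNReal.toReal_ofReal', ENNReal.toReal_ofReal']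
  exact abs_max_sub_max_le_abs x y 0

lemma psi_inv_toReal_inv (hp : 0 < p) : psi (ENNReal.ofReal p⁻¹.toReal)⁻¹ = psi p := by
  rw [ENNReal.ofReal_toReal (ENNReal.inv_ne_top.2 hp.ne'), inv_inv]

lemma toReal_inv_le_inv (hm : 0 < m) (hp : m ≤ p) : p⁻¹.toReal ≤ (m : ℝ)⁻¹ := by
  calc p⁻¹.toReal ≤ (m : ℝ≥0∞)⁻¹.toReal :=
        ENNReal.toReal_mono (by simpa using hm.ne') (ENNReal.inv_le_inv.2 hp)
    _ = (m : ℝ)⁻¹ := by simp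

lemma norm_psi_le (hm : 0 < m) (hp : m ≤ p) : ‖psi p‖ ≤ (m : ℝ)⁻¹ := by
  have hp0 : 0 < p := (ENNReal.coe_pos.2 hm).trans_le hp
  refine le_trans ?_ (toReal_inv_le_inv hm hp)
  simpa [psi_top] using norm_psi_sub_le_of_le hp0 le_top

lemma stronglyMeasurable_psi_comp {α : Type*} [MeasurableSpace α] {P : α → ℝ≥0∞}
    (hP : IsVarExponent P) : StronglyMeasurable fun ω => psi (P ω) := by
  have hmeas : StronglyMeasurable fun ω => (P ω)⁻¹.toReal :=
    hP.1.inv.ennreal_toReal.stronglyMeasurable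
  simpa only [psi_inv_toReal_inv (hP.2 _)] using
    lipschitzWith_psi_inv.continuous.comp_stronglyMeasurable hmeas

lemma continuousAt_psi (hq : 0 < q) : ContinuousAt psi q := by
  refine tendsto_iff_norm_sub_tendsto_zero.2 ?_
  have hlim : Tendsto (fun p : ℝ≥0∞ => |p⁻¹.toReal - q⁻¹.toReal|) (𝓝 q) (𝓝 0) := by
    have hinv : Tendsto (fun p : ℝ≥0∞ => p⁻¹.toReal) (𝓝 q) (𝓝 q⁻¹.toReal) :=
      (ENNReal.tendsto_toReal (ENNReal.inv_ne_top.2 hq.ne')).comp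
        (continuous_inv.tendsto q)
    simpa using (hinv.sub_const q⁻¹.toReal).abs
  refine squeeze_zero' (Eventually.of_forall fun _ => norm_nonneg _) ?_ hlim
  filter_upwards [lt_mem_nhds hq] with p hp
  exact norm_psi_sub_le hp hq

variable {R : Set ℝ≥0∞} {k : C(I, ℝ)}

lemma isCompact_convexPowers (hm : 0 < m) (hR : ∀ p ∈ R, (m : ℝ≥0∞) ≤ p) :
    IsCompact (convexPowers R) := by
  have hsub : psi '' R ⊆ (fun x : ℝ => psi (ENNReal.ofReal x)⁻¹) '' Set.Icc 0 (m : ℝ)⁻¹ := by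
    rintro _ ⟨p, hp, rfl⟩
    exact ⟨p⁻¹.toReal, ⟨ENNReal.toReal_nonneg, toReal_inv_le_inv hm (hR p hp)⟩,
      psi_inv_toReal_inv ((ENNReal.coe_pos.2 hm).trans_le (hR p hp))⟩
  have himage := isCompact_Icc.image (f := fun x : ℝ => psi (ENNReal.ofReal x)⁻¹)
    lipschitzWith_psi_inv.continuous (s := Set.Icc 0 (m : ℝ)⁻¹)
  exact (totallyBounded_convexHull.2
    (himage.totallyBounded.subset hsub)).closure.isCompact_of_isClosed isClosed_closure

lemma psi_mem_convexPowers (hp : p ∈ R) : psi p ∈ convexPowers R :=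
  subset_closure (subset_convexHull ℝ _ (Set.mem_image_of_mem _ hp))

lemma convex_convexPowers (R : Set ℝ≥0∞) : Convex ℝ (convexPowers R) :=
  (convex_convexHull ℝ _).closure

lemma apply_mul_le_of_mem_convexPowers (hR : ∀ p ∈ R, (m : ℝ≥0∞) ≤ p)
    (hk : k ∈ convexPowers R) (s t : I) : k (s * t) ≤ (s : ℝ) ^ (m : ℝ) * k t := by
  have hconv : Convex ℝ {k : C(I, ℝ) | k (s * t) ≤ (s : ℝ) ^ (m : ℝ) * k t} := by
    intro f hf g hg a b ha hb _
    have hf' := mul_le_mul_of_nonneg_left hf ha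
    have hg' := mul_le_mul_of_nonneg_left hg hb
    simp only [Set.mem_ofPred_eq, ContinuousMap.add_apply, ContinuousMap.smul_apply, smul_eq_mul]
    linarith
  have hclosed : IsClosed {k : C(I, ℝ) | k (s * t) ≤ (s : ℝ) ^ (m : ℝ) * k t} :=
    isClosed_le (continuous_eval_const _) (continuous_const.mul (continuous_eval_const t))
  refine closure_minimal (convexHull_min ?_ hconv) hclosed hk
  rintro _ ⟨p, hp, rfl⟩
  exact psi_mul_le (hR p hp) s t

end Powers

section OrliczOf

variable {R : Set ℝ≥0∞} {k : C(I, ℝ)} {m : ℝ≥0}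

/-- The extension of a function on `[0,1]` to `[0,∞)` by `∞`; it serves as a representative of the
class of Orlicz functions that are equivalent to `k` near zero. -/
noncomputable def orliczOf (k : C(I, ℝ)) (t : ℝ≥0) : ℝ≥0∞ :=
  if t ≤ 1 then ENNReal.ofReal (k (Set.projIcc 0 1 zero_le_one (t : ℝ))) else ∞

lemma orliczOf_toNNReal (k : C(I, ℝ)) (t : I) :
    orliczOf k (unitInterval.toNNReal t) = ENNReal.ofReal (k t) := by
  have ht : unitInterval.toNNReal t ≤ 1 := t.2.2
  rw [orliczOf, if_pos ht, unitInterval.coe_toNNReal, Set.projIcc_val]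

lemma exists_toNNReal_eq {t : ℝ≥0} (ht : t ≤ 1) : ∃ u : I, unitInterval.toNNReal u = t :=
  ⟨⟨t, t.2, ht⟩, rfl⟩

lemma orliczOf_of_one_lt (k : C(I, ℝ)) {t : ℝ≥0} (ht : 1 < t) : orliczOf k t = ∞ :=
  if_neg ht.not_ge

lemma hasLowerType_orliczOf (hm : 0 < m) (hR : ∀ p ∈ R, (m : ℝ≥0∞) ≤ p)
    (hk : k ∈ convexPowers R) : HasLowerType m (orliczOf k) := by
  intro s t hs
  obtain ⟨u, rfl⟩ := exists_toNNReal_eq hs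
  have hu : ((unitInterval.toNNReal u : ℝ≥0) : ℝ≥0∞) ^ (m : ℝ) =
      ENNReal.ofReal ((u : ℝ) ^ (m : ℝ)) := by
    rw [← ENNReal.ofReal_rpow_of_nonneg u.2.1 m.coe_nonneg, ENNReal.ofReal,
      ← unitInterval.coe_toNNReal, Real.toNNReal_coe]
  rw [hu]
  have hscale : ∀ v : I, orliczOf k (unitInterval.toNNReal u * unitInterval.toNNReal v) ≤
      ENNReal.ofReal ((u : ℝ) ^ (m : ℝ)) * orliczOf k (unitInterval.toNNReal v) := fun v => by
    have hmul : unitInterval.toNNReal u * unitInterval.toNNReal v = unitInterval.toNNReal (u * v) :=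
      rfl
    rw [hmul, orliczOf_toNNReal, orliczOf_toNNReal, ← ENNReal.ofReal_mul (Real.rpow_nonneg u.2.1 _)]
    exact ENNReal.ofReal_le_ofReal (apply_mul_le_of_mem_convexPowers hR hk u v)
  rcases le_or_gt t 1 with ht | ht
  · obtain ⟨v, rfl⟩ := exists_toNNReal_eq ht
    exact hscale v
  rcases eq_or_lt_of_le u.2.1 with hu0 | hu0
  · have hu' : unitInterval.toNNReal u = 0 := NNReal.eq (by simpa using hu0.symm)
    simpa [hu', ← hu0, hm.ne'] using hscale 0
  · rw [orliczOf_of_one_lt k ht, ENNReal.mul_top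
      (ENNReal.ofReal_pos.2 (Real.rpow_pos_of_pos hu0 _)).ne']
    exact le_top

lemma continuousWithinAt_Iic_orliczOf (k : C(I, ℝ)) (t : ℝ≥0) :
    ContinuousWithinAt (orliczOf k) (Set.Iic t) t := by
  rcases le_or_gt t 1 with ht | ht
  · have hcont : Continuous fun t : ℝ≥0 =>
        ENNReal.ofReal (k (Set.projIcc 0 1 zero_le_one (t : ℝ))) :=
      ENNReal.continuous_ofReal.comp (by fun_prop)
    exact hcont.continuousWithinAt.congr (fun u hu => if_pos (hu.trans ht)) (if_pos ht)
  · refine (continuousWithinAt_const (b := (∞ : ℝ≥0∞))).congr_of_eventuallyEq ?_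
      (orliczOf_of_one_lt k ht)
    filter_upwards [nhdsWithin_le_nhds (Ioi_mem_nhds ht)] with u hu
    exact orliczOf_of_one_lt k hu

lemma orliczGen_orliczOf (hm : 0 < m) (hR : ∀ p ∈ R, (m : ℝ≥0∞) ≤ p) (hk : k ∈ convexPowers R) :
    OrliczGen R (orliczOf k) := by
  have hlower := hasLowerType_orliczOf hm hR hk
  refine ⟨⟨hlower.monotone, continuousWithinAt_Iic_orliczOf k,
    hlower.tendsto_zero hm (by simp [orliczOf]), ∞, by simp, tendsto_const_nhds.congr' ?_⟩,
    1, one_pos, le_rfl, k, hk, 1, 1, one_pos, one_pos, fun t _ => by simp [orliczOf_toNNReal]⟩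
  filter_upwards [eventually_gt_atTop 1] with t ht
  exact (orliczOf_of_one_lt k ht).symm

end OrliczOf

namespace SequenceSpace

variable {𝕜 : Type*} [RCLike 𝕜] {S : SequenceSpace 𝕜} {G H : ℕ → ℝ≥0 → ℝ≥0∞}
  {F : ℝ≥0 → ℝ≥0∞} {m : ℝ≥0}

/-- `S` is the Musielak–Orlicz sequence space defined by the functions `G n`, with equivalent
quasi-norms. -/
def IsMusielakOrlicz (S : SequenceSpace 𝕜) (G : ℕ → ℝ≥0 → ℝ≥0∞) : Prop :=
  (∃ C : ℝ≥0, ∀ a : S.carrier, luxemburg G Measure.count (a : ℕ → 𝕜) ≤ C * S.nrm a) ∧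
  ∃ C : ℝ≥0, ∀ a : ℕ → 𝕜, luxemburg G Measure.count a < ∞ →
    ∃ h : a ∈ S.carrier, (S.nrm ⟨a, h⟩ : ℝ≥0∞) ≤ C * luxemburg G Measure.count a

lemma IsMusielakOrlicz.congr (hS : S.IsMusielakOrlicz G)
    (hHG : ∃ C : ℝ≥0, ∀ a : ℕ → 𝕜,
      luxemburg H Measure.count a ≤ C * luxemburg G Measure.count a)
    (hGH : ∃ C : ℝ≥0, ∀ a : ℕ → 𝕜,
      luxemburg G Measure.count a ≤ C * luxemburg H Measure.count a) :
    S.IsMusielakOrlicz H := by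
  obtain ⟨⟨C₁, hC₁⟩, C₂, hC₂⟩ := hS
  obtain ⟨D₁, hD₁⟩ := hHG
  obtain ⟨D₂, hD₂⟩ := hGH
  refine ⟨⟨D₁ * C₁, fun a => ?_⟩, C₂ * D₂, fun a ha => ?_⟩
  · calc luxemburg H Measure.count (a : ℕ → 𝕜) ≤ D₁ * luxemburg G Measure.count (a : ℕ → 𝕜) := hD₁ a
      _ ≤ D₁ * (C₁ * S.nrm a) := by gcongr; exact hC₁ a
      _ = (D₁ * C₁ : ℝ≥0) * S.nrm a := by rw [ENNReal.coe_mul, mul_assoc]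
  · obtain ⟨h, hle⟩ := hC₂ a ((hD₂ a).trans_lt (ENNReal.mul_lt_top ENNReal.coe_lt_top ha))
    refine ⟨h, hle.trans ?_⟩
    rw [ENNReal.coe_mul, mul_assoc]
    gcongr
    exact hD₂ a

lemma luxemburg_extend {π : ℕ → ℕ} (hπ : Function.Injective π) (hG : ∀ n, G n 0 = 0)
    (a : ℕ → 𝕜) : luxemburg G Measure.count (Function.extend π a 0) =
      luxemburg (fun n => G (π n)) Measure.count a := by
  have hmod : ∀ t : ℝ≥0, modular G Measure.count (fun n => ‖Function.extend π a 0 n‖₊ / t) =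
      modular (fun n => G (π n)) Measure.count fun n => ‖a n‖₊ / t := fun t => by
    rw [modular_count, modular_count, ← hπ.tsum_eq]
    · simp only [hπ.extend_apply]
    · refine Function.support_subset_iff'.2 fun n hn => ?_
      rw [Function.extend_apply' _ _ _ (by simpa using hn)]
      simp [hG]
  simp only [luxemburg, hmod]

lemma IsSubsymmetric.exists_nrm_eq_nrm_extend (hS : S.IsSubsymmetric) {π : ℕ → ℕ}
    (hπ : StrictMono π) {a : ℕ → 𝕜} (h : Function.extend π a 0 ∈ S.carrier) :
    ∃ ha : a ∈ S.carrier, S.nrm ⟨a, ha⟩ = S.nrm ⟨_, h⟩ := by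
  have hsupp : Function.support (Function.extend π a 0) ⊆ Set.range π :=
    Function.support_subset_iff'.2 fun n hn => Function.extend_apply' _ _ _ (by simpa using hn)
  simpa only [hπ.injective.extend_apply] using (hS π hπ).1 ⟨_, h⟩ hsupp

lemma IsSubsymmetric.extend_mem (hS : S.IsSubsymmetric) {π : ℕ → ℕ} (hπ : StrictMono π)
    (a : S.carrier) : Function.extend π (a : ℕ → 𝕜) 0 ∈ S.carrier := by
  obtain ⟨f, hsupp, hfπ⟩ := (hS π hπ).2 a
  convert f.2
  funext n
  by_cases hn : n ∈ Set.range π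
  · obtain ⟨k, rfl⟩ := hn
    rw [hπ.injective.extend_apply, hfπ]
  · rw [Function.extend_apply' _ _ _ (by simpa using hn), Pi.zero_apply,
      Function.support_subset_iff'.1 hsupp n hn]

lemma IsMusielakOrlicz.comp_strictMono (hS : S.IsMusielakOrlicz G) (hsub : S.IsSubsymmetric)
    (hG : ∀ n, G n 0 = 0) {π : ℕ → ℕ} (hπ : StrictMono π) :
    S.IsMusielakOrlicz fun n => G (π n) := by
  obtain ⟨⟨C₁, hC₁⟩, C₂, hC₂⟩ := hS
  refine ⟨⟨C₁, fun a => ?_⟩, C₂, fun a ha => ?_⟩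
  · obtain ⟨_, hnrm⟩ := hsub.exists_nrm_eq_nrm_extend hπ (hsub.extend_mem hπ a)
    rw [← luxemburg_extend hπ.injective hG]
    exact (hC₁ ⟨_, hsub.extend_mem hπ a⟩).trans_eq (by rw [← hnrm])
  · rw [← luxemburg_extend hπ.injective hG] at ha ⊢
    obtain ⟨h, hle⟩ := hC₂ _ ha
    obtain ⟨ha', hnrm⟩ := hsub.exists_nrm_eq_nrm_extend hπ h
    exact ⟨ha', hnrm ▸ hle⟩

lemma IsMusielakOrlicz.eqOrliczSpace (hm : 0 < m) (hF : HasLowerType m F)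
    (hS : S.IsMusielakOrlicz fun _ => F) : S.EqOrliczSpace F := by
  have hF' : ∀ᵐ _ : ℕ ∂Measure.count, HasLowerType m F := ae_of_all _ fun _ => hF
  obtain ⟨⟨C₁, hC₁⟩, C₂, hC₂⟩ := hS
  refine ⟨fun a => ?_, fun u ε hu hε => ?_, fun δ hδ => ?_⟩
  · rw [memMO_iff_luxemburg_lt_top hm hF']
    exact ⟨fun ha => (hC₁ ⟨a, ha⟩).trans_lt
      (ENNReal.mul_lt_top ENNReal.coe_lt_top ENNReal.coe_lt_top), fun ha => (hC₂ a ha).1⟩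
  · obtain ⟨s, hs0, hs1, hs⟩ :=
      exists_coe_rpow_mul_lt hm ENNReal.one_ne_top (ENNReal.coe_pos.2 hε)
    refine ⟨s * u / (C₁ + 1), by positivity, fun a ha => ?_⟩
    have hlux : luxemburg (fun _ => F) Measure.count (a : ℕ → 𝕜) < (s * u : ℝ≥0) := by
      refine (hC₁ a).trans_lt ?_
      rw [← ENNReal.coe_mul, ENNReal.coe_lt_coe]
      rw [lt_div_iff₀' (by positivity)] at ha
      exact (mul_le_mul_left le_self_add _).trans_lt ha
    have hscale : ∀ n, ‖(a : ℕ → 𝕜) n‖₊ / u = s * (‖(a : ℕ → 𝕜) n‖₊ / (s * u)) := fun n => by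
      field_simp
    simp_rw [hscale]
    calc modular (fun _ => F) Measure.count (fun n => s * (‖(a : ℕ → 𝕜) n‖₊ / (s * u)))
        ≤ (s : ℝ≥0∞) ^ (m : ℝ) *
          modular (fun _ => F) Measure.count fun n => ‖(a : ℕ → 𝕜) n‖₊ / (s * u) :=
          modular_mul_le hF' hs1 _
      _ ≤ (s : ℝ≥0∞) ^ (m : ℝ) * 1 := by
          gcongr
          exact (modular_lt_one_of_luxemburg_lt (hF'.mono fun _ h => h.monotone) hlux).le
      _ < ε := hs
  · refine ⟨δ / (C₂ + 1), 1, by positivity, one_pos, fun a ha => ?_⟩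
    have hlux := luxemburg_le (f := (a : ℕ → 𝕜)) (by positivity) ha
    obtain ⟨_, hle⟩ := hC₂ a (hlux.trans_lt ENNReal.coe_lt_top)
    have hnrm : (S.nrm a : ℝ≥0∞) ≤ (C₂ * (δ / (C₂ + 1)) : ℝ≥0) := by
      rw [ENNReal.coe_mul]
      exact hle.trans (by gcongr)
    refine (ENNReal.coe_le_coe.1 hnrm).trans_lt ?_
    rw [mul_div_left_comm]
    exact mul_lt_of_lt_one_right hδ ((div_lt_one (by positivity)).2 (by simp))

lemma nrm_coe_smul (c : ℝ≥0) (a : S.carrier) : S.nrm (((c : ℝ) : 𝕜) • a) = c * S.nrm a := by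
  rw [S.nrm_smul]
  congr 1
  ext
  simp

lemma nnnorm_coe_smul_apply (c : ℝ≥0) (a : ℕ → 𝕜) (n : ℕ) :
    ‖(((c : ℝ) : 𝕜) • a) n‖₊ = c * ‖a n‖₊ := by
  ext
  simp

lemma EqOrliczSpace.exists_luxemburg_le_mul_nrm {H : ℝ≥0 → ℝ≥0∞} {ε d : ℝ≥0}
    (hS : S.EqOrliczSpace F) (hε : 0 < ε) (hd : 0 < d)
    (hHF : ∀ x : ℕ → ℝ≥0, ∑' n, F (x n) < ε → ∑' n, H (d * x n) < 1) :
    ∃ C : ℝ≥0, ∀ a : S.carrier,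
      luxemburg (fun _ => H) Measure.count (a : ℕ → 𝕜) ≤ C * S.nrm a := by
  obtain ⟨δ, hδ, hδF⟩ := hS.2.1 1 ε one_pos hε
  simp only [modular_count] at hδF
  refine ⟨(d * δ)⁻¹, fun a => luxemburg_le_mul (by positivity) fun t ht => ?_⟩
  rw [ENNReal.coe_lt_coe] at ht
  have ht0 : 0 < t := zero_le.trans_lt ht
  have hnrm : S.nrm ((((δ / t : ℝ≥0) : ℝ) : 𝕜) • a) < δ := by
    rw [nrm_coe_smul, div_mul_eq_mul_div, mul_div_assoc]
    exact mul_lt_of_lt_one_right hδ ((div_lt_one ht0).2 ht)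
  rw [modular_count]
  convert hHF _ (hδF _ hnrm) using 4 with n
  rw [Submodule.coe_smul, nnnorm_coe_smul_apply]
  field_simp

lemma EqOrliczSpace.exists_nrm_le_mul_luxemburg {H : ℝ≥0 → ℝ≥0∞} (hS : S.EqOrliczSpace F)
    (hH : Monotone H) (hFH : ∀ ε : ℝ≥0, 0 < ε → ∃ d : ℝ≥0, 0 < d ∧
      ∀ x : ℕ → ℝ≥0, ∑' n, H (x n) < 1 → ∑' n, F (d * x n) < ε) :
    ∃ C : ℝ≥0, ∀ a : ℕ → 𝕜, luxemburg (fun _ => H) Measure.count a < ∞ →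
      ∃ h : a ∈ S.carrier,
        (S.nrm ⟨a, h⟩ : ℝ≥0∞) ≤ C * luxemburg (fun _ => H) Measure.count a := by
  obtain ⟨u, ε, hu, hε, hnrm_lt⟩ := hS.2.2 1 one_pos
  obtain ⟨d, hd, hdF⟩ := hFH ε hε
  simp only [← modular_count] at hdF
  have hscaled : ∀ (a : ℕ → 𝕜) (t : ℝ≥0), luxemburg (fun _ => H) Measure.count a < t →
      ∃ h : a ∈ S.carrier, S.nrm ⟨a, h⟩ ≤ (d * u)⁻¹ * t := by
    intro a t ht
    have ht0 : 0 < t := ENNReal.coe_pos.1 (zero_le.trans_lt ht)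
    have hmod := hdF _ (modular_lt_one_of_luxemburg_lt (ae_of_all _ fun _ => hH) ht)
    have hscale (n : ℕ) : d * (‖a n‖₊ / t) = ‖((((d * u / t : ℝ≥0) : ℝ) : 𝕜) • a) n‖₊ / u := by
      rw [nnnorm_coe_smul_apply]
      field_simp
    simp_rw [hscale] at hmod
    have hb : (((d * u / t : ℝ≥0) : ℝ) : 𝕜) • a ∈ S.carrier :=
      (hS.1 _).2 ⟨u⁻¹, inv_pos.2 hu, by
        simp_rw [← div_eq_inv_mul]
        exact hmod.trans ENNReal.coe_lt_top⟩
    have hc : (((d * u / t : ℝ≥0) : ℝ) : 𝕜) ≠ 0 := by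
      rw [Ne, RCLike.ofReal_eq_zero]
      positivity
    have ha : a ∈ S.carrier := (Submodule.smul_mem_iff _ hc).1 hb
    refine ⟨ha, ?_⟩
    have hnrm : S.nrm ((((d * u / t : ℝ≥0) : ℝ) : 𝕜) • ⟨a, ha⟩) < 1 := hnrm_lt _ hmod
    rw [nrm_coe_smul, div_mul_eq_mul_div, div_lt_one ht0] at hnrm
    rw [← div_eq_inv_mul, le_div_iff₀' (by positivity)]
    exact hnrm.le
  refine ⟨(d * u)⁻¹, fun a ha => ?_⟩
  obtain ⟨t, ht, -⟩ := ENNReal.lt_iff_exists_nnreal_btwn.1 ha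
  refine ⟨(hscaled a t ht).1, le_coe_mul_of_forall_lt (by positivity) fun s hs => ?_⟩
  exact_mod_cast (hscaled a s hs).2

lemma IsSubsymmetric.nrm_unitVec (hS : S.IsSubsymmetric) (n : ℕ) :
    S.nrm (S.unitVec n) = S.nrm (S.unitVec 0) := by
  have hπ : StrictMono fun k : ℕ => k + n := fun i j h => Nat.add_lt_add_right h n
  have hsupp : Function.support (S.unitVec n : ℕ → 𝕜) ⊆ Set.range fun k : ℕ => k + n :=
    Pi.support_single_subset.trans (by simp)
  obtain ⟨h, hnrm⟩ := (hS _ hπ).1 (S.unitVec n) hsupp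
  rw [← hnrm]
  congr 2
  funext k
  simp [unitVec, Pi.single_apply]

lemma nrm_unitVec_pos (n : ℕ) : 0 < S.nrm (S.unitVec n) :=
  pos_iff_ne_zero.2 fun h => by
    simpa [unitVec] using congrFun (congrArg Subtype.val (S.nrm_eq_zero _ h)) n

lemma modular_unitVec_div (hG : ∀ n, G n 0 = 0) (n : ℕ) (t : ℝ≥0) :
    modular G Measure.count (fun k => ‖(S.unitVec n : ℕ → 𝕜) k‖₊ / t) = G n t⁻¹ := by
  rw [modular_count, tsum_eq_single n fun k hk => by simp [unitVec, hk, hG]]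
  simp [unitVec]

lemma IsMusielakOrlicz.exists_pos_forall_le_one (hS : S.IsMusielakOrlicz G)
    (hsub : S.IsSubsymmetric) (hG : ∀ n, Monotone (G n)) (hG0 : ∀ n, G n 0 = 0) :
    ∃ b : ℝ≥0, 0 < b ∧ ∀ n, G n b ≤ 1 := by
  obtain ⟨⟨C, hC⟩, -⟩ := hS
  refine ⟨(C * S.nrm (S.unitVec 0) + 1)⁻¹, by positivity, fun n => ?_⟩
  rw [← modular_unitVec_div (S := S) hG0]
  refine (modular_lt_one_of_luxemburg_lt (ae_of_all _ hG) ?_).le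
  refine (hC (S.unitVec n)).trans_lt ?_
  rw [hsub.nrm_unitVec]
  exact_mod_cast lt_add_one _

lemma IsMusielakOrlicz.exists_forall_one_le (hS : S.IsMusielakOrlicz G)
    (hsub : S.IsSubsymmetric) (hG0 : ∀ n, G n 0 = 0) : ∃ B : ℝ≥0, ∀ n, 1 ≤ G n B := by
  obtain ⟨-, C, hC⟩ := hS
  have hN : 0 < S.nrm (S.unitVec 0) := nrm_unitVec_pos 0
  refine ⟨(S.nrm (S.unitVec 0) / (C + 1))⁻¹, fun n => ?_⟩
  by_contra! hlt
  rw [← modular_unitVec_div (S := S) hG0] at hlt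
  have hlux := luxemburg_le (by positivity) hlt
  obtain ⟨h, hle⟩ := hC _ (hlux.trans_lt ENNReal.coe_lt_top)
  have hnrm : (S.nrm (S.unitVec n) : ℝ≥0∞) ≤ (C * (S.nrm (S.unitVec 0) / (C + 1)) : ℝ≥0) := by
    rw [ENNReal.coe_mul]
    exact hle.trans (by gcongr)
  rw [ENNReal.coe_le_coe, hsub.nrm_unitVec, mul_div_left_comm] at hnrm
  exact hnrm.not_gt (mul_lt_of_lt_one_right hN ((div_lt_one (by positivity)).2 (by simp)))

/-- The restriction of a sequence to its first `n` coordinates, as an element of `S`. -/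
noncomputable def truncate (S : SequenceSpace 𝕜) (a : ℕ → 𝕜) (n : ℕ) : S.carrier :=
  ∑ i ∈ Finset.range n, a i • S.unitVec i

lemma truncate_apply (a : ℕ → 𝕜) (n j : ℕ) :
    (S.truncate a n : ℕ → 𝕜) j = if j < n then a j else 0 := by
  rw [truncate, Submodule.coe_sum, Finset.sum_apply]
  simp [unitVec, Pi.single_apply]

lemma nrm_truncate_le (a : S.carrier) (n : ℕ) : S.nrm (S.truncate a n) ≤ S.nrm a := by
  obtain ⟨_, hle⟩ := S.lattice a (S.truncate a n) fun j => by
    rw [truncate_apply]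
    split_ifs <;> simp
  exact hle

lemma exists_nrm_le_of_forall_nrm_truncate_le (S : SequenceSpace 𝕜) :
    ∃ D : ℝ≥0, ∀ (a : ℕ → 𝕜) (r : ℝ≥0∞), r < ∞ → (∀ n, (S.nrm (S.truncate a n) : ℝ≥0∞) ≤ r) →
      ∃ h : a ∈ S.carrier, (S.nrm ⟨a, h⟩ : ℝ≥0∞) ≤ D * r := by
  obtain ⟨D, hD⟩ := S.fatou
  refine ⟨D, fun a r hr hle => ?_⟩
  have hlim : ∀ j, Tendsto (fun n => (S.truncate a n : ℕ → 𝕜) j) atTop (𝓝 (a j)) := fun j => by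
    refine tendsto_const_nhds.congr' ?_
    filter_upwards [eventually_gt_atTop j] with n hn
    rw [truncate_apply, if_pos hn]
  have hsup : limsup (fun n => (S.nrm (S.truncate a n) : ℝ≥0∞)) atTop ≤ r :=
    limsup_le_of_le (h := Eventually.of_forall hle)
  obtain ⟨h, hnrm⟩ := hD (S.truncate a) a hlim (hsup.trans_lt hr)
  exact ⟨h, hnrm.trans (by gcongr)⟩

end SequenceSpace

section DisjointSupports

variable {𝕜 : Type*} [RCLike 𝕜]

lemma map_nnnorm_sum_of_disjoint {F : ℝ≥0 → ℝ≥0∞} (hF : F 0 = 0) (r : ℝ≥0) (a x : ℕ → 𝕜)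
    (hx : ∀ i j, i ≠ j → x i = 0 ∨ x j = 0) (n : ℕ) :
    F (r * ‖∑ i ∈ Finset.range n, a i * x i‖₊) =
      ∑ i ∈ Finset.range n, F (r * ‖a i‖₊ * ‖x i‖₊) := by
  by_cases h : ∃ i ∈ Finset.range n, x i ≠ 0
  · obtain ⟨i, hi, hxi⟩ := h
    have h0 : ∀ j, j ≠ i → x j = 0 := fun j hj => (hx j i hj).resolve_right hxi
    rw [Finset.sum_eq_single_of_mem i hi fun j _ hj => by rw [h0 j hj, mul_zero],
      Finset.sum_eq_single_of_mem i hi fun j _ hj => by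
        rw [h0 j hj, nnnorm_zero, mul_zero, hF], nnnorm_mul, mul_assoc]
  · push Not at h
    rw [Finset.sum_eq_zero fun i hi => by rw [h i hi, mul_zero],
      Finset.sum_eq_zero fun i hi => by rw [h i hi, nnnorm_zero, mul_zero, hF],
      nnnorm_zero, mul_zero, hF]

namespace SequenceSpace

variable {S : SequenceSpace 𝕜} {Ω : Type*} [MeasurableSpace Ω] {μ : Measure Ω} {P : Ω → ℝ≥0∞}
  {m : ℝ≥0}

lemma map_truncate (T : S.carrier →ₗ[𝕜] (Ω →ₘ[μ] 𝕜)) (a : ℕ → 𝕜) (n : ℕ) :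
    ∀ᵐ ω ∂μ, T (S.truncate a n) ω = ∑ i ∈ Finset.range n, a i * T (S.unitVec i) ω := by
  induction n with
  | zero =>
    filter_upwards [AEEqFun.coeFn_zero (α := Ω) (β := 𝕜) (μ := μ)] with ω hω
    simpa [truncate] using hω
  | succ n ih =>
    have hsucc : T (S.truncate a (n + 1)) = T (S.truncate a n) + a n • T (S.unitVec n) := by
      rw [truncate, Finset.sum_range_succ, map_add, map_smul, truncate]
    filter_upwards [ih, AEEqFun.coeFn_add (T (S.truncate a n)) (a n • T (S.unitVec n)),
      AEEqFun.coeFn_smul (a n) (T (S.unitVec n))] with ω hsum hadd hsmul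
    rw [hsucc, hadd, Pi.add_apply, hsum, hsmul, Finset.sum_range_succ, Pi.smul_apply, smul_eq_mul]

lemma modular_map_truncate (hP : IsVarExponent P) (T : S.carrier →ₗ[𝕜] (Ω →ₘ[μ] 𝕜))
    (hT : ∀ m n, m ≠ n → ∀ᵐ ω ∂μ, T (S.unitVec m) ω = 0 ∨ T (S.unitVec n) ω = 0)
    (a : ℕ → 𝕜) (n : ℕ) (r : ℝ≥0) :
    modular (expMO P) μ (fun ω => r * ‖T (S.truncate a n) ω‖₊) =
      ∑ i ∈ Finset.range n,
        modularDilation (expMO P) μ (fun ω => ‖T (S.unitVec i) ω‖₊) (r * ‖a i‖₊) := by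
  simp only [modularDilation, modular]
  rw [← lintegral_finsetSum]
  · have hT' : ∀ᵐ ω ∂μ, ∀ m n, m ≠ n → T (S.unitVec m) ω = 0 ∨ T (S.unitVec n) ω = 0 := by
      simpa only [ae_all_iff] using hT
    refine lintegral_congr_ae ?_
    filter_upwards [map_truncate T a n, hT'] with ω hsum hdisj
    rw [hsum]
    exact map_nnnorm_sum_of_disjoint (powerFn_zero (hP.2 ω)) r a _ hdisj n
  · exact fun i _ => measurable_powerFn hP.1
      ((AEEqFun.stronglyMeasurable _).measurable.nnnorm.const_mul _)

lemma luxemburg_map_truncate_le (hP : IsVarExponent P) (T : S.carrier →ₗ[𝕜] (Ω →ₘ[μ] 𝕜))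
    (hT : ∀ m n, m ≠ n → ∀ᵐ ω ∂μ, T (S.unitVec m) ω = 0 ∨ T (S.unitVec n) ω = 0)
    (a : ℕ → 𝕜) (n : ℕ) :
    luxemburg (expMO P) μ (T (S.truncate a n)) ≤
      luxemburg (fun i => modularDilation (expMO P) μ fun ω => ‖T (S.unitVec i) ω‖₊)
        Measure.count a := by
  refine le_of_forall_gt fun r hr => ?_
  obtain ⟨t, ht, hlt, htr⟩ := luxemburg_lt_iff.1 hr
  refine (luxemburg_le ht ?_).trans_lt htr
  simp_rw [div_eq_inv_mul] at hlt ⊢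
  rw [modular_map_truncate hP T hT]
  exact (ENNReal.sum_le_tsum _).trans_lt (modular_count _ _ ▸ hlt)

lemma DisjointlyEmbeds.exists_isMusielakOrlicz (hm : 0 < m) (hP : IsVarExponent P)
    (hmP : ∀ᵐ ω ∂μ, (m : ℝ≥0∞) ≤ P ω) (hS : S.DisjointlyEmbeds μ P) :
    ∃ f : ℕ → Ω → ℝ≥0, (∀ n, Measurable (f n)) ∧
      S.IsMusielakOrlicz fun n => modularDilation (expMO P) μ (f n) := by
  obtain ⟨T, -, ⟨C, hC⟩, hT⟩ := hS
  have hM : ∀ᵐ ω ∂μ, HasLowerType m (expMO P ω) := hmP.mono fun ω => hasLowerType_powerFn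
  have hmono : ∀ᵐ ω ∂μ, Monotone (expMO P ω) := hM.mono fun ω hω => hω.monotone
  refine ⟨fun n ω => ‖T (S.unitVec n) ω‖₊,
    fun n => (AEEqFun.stronglyMeasurable _).measurable.nnnorm, ?_, ?_⟩
  · obtain ⟨C', hC'⟩ := exists_luxemburg_le_mul 𝕜 hm (μ := Measure.count)
      (ae_of_all _ fun n => hasLowerType_modularDilation hM fun ω => ‖T (S.unitVec n) ω‖₊)
      (inv_pos.2 (add_pos_of_nonneg_of_pos (zero_le (a := C)) one_pos)) ENNReal.one_ne_top
    refine ⟨C', fun a => hC' _ _ fun t ht => ?_⟩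
    rw [ENNReal.coe_lt_coe] at ht
    rw [modular_count]
    refine ENNReal.tsum_le_of_sum_range_le fun n => ?_
    have hlux : luxemburg (expMO P) μ (T (S.truncate a n)) < ((C + 1) * t : ℝ≥0) := by
      refine (hC _).1.trans_lt ?_
      rw [← ENNReal.coe_mul, ENNReal.coe_lt_coe]
      calc C * S.nrm (S.truncate a n) ≤ C * t := by gcongr; exact (nrm_truncate_le a n).trans ht.le
        _ < (C + 1) * t := by gcongr; exacts [zero_le.trans_lt ht, lt_add_one C]
    have hscale : ∀ i, (C + 1)⁻¹ * (‖(a : ℕ → 𝕜) i‖₊ / t) =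
        ((C + 1) * t)⁻¹ * ‖(a : ℕ → 𝕜) i‖₊ := fun i => by
      rw [mul_inv, div_eq_inv_mul, mul_assoc]
    simp_rw [hscale, ← modular_map_truncate hP T hT, ← div_eq_inv_mul]
    exact (modular_lt_one_of_luxemburg_lt hmono hlux).le
  · obtain ⟨D, hD⟩ := S.exists_nrm_le_of_forall_nrm_truncate_le
    refine ⟨D * C, fun a ha => ?_⟩
    rw [ENNReal.coe_mul, mul_assoc]
    refine hD a _ (ENNReal.mul_lt_top ENNReal.coe_lt_top ha) fun n => (hC _).2.trans ?_
    gcongr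
    exact luxemburg_map_truncate_le hP T hT a n

end SequenceSpace

end DisjointSupports

section Perturbation

lemma exists_strictMono_tsum_edist_ne_top {X : Type*} [PseudoEMetricSpace X] {K : Set X}
    (hK : IsCompact K) {u : ℕ → X} (hu : ∀ n, u n ∈ K) :
    ∃ a ∈ K, ∃ π : ℕ → ℕ, StrictMono π ∧ ∑' n, edist (u (π n)) a ≠ ∞ := by
  obtain ⟨a, ha, φ, hφ, hlim⟩ := hK.tendsto_subseq hu
  obtain ⟨ε, hε, hsum⟩ := ENNReal.exists_pos_sum_of_countable' one_ne_zero ℕ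
  obtain ⟨ψ, hψ, hdist⟩ := extraction_forall_of_eventually' fun n : ℕ =>
    eventually_atTop.1 (hlim.eventually (Metric.eball_mem_nhds a (hε n)))
  exact ⟨a, ha, φ ∘ ψ, hφ.comp hψ,
    ne_top_of_le_ne_top hsum.ne_top (ENNReal.tsum_le_tsum fun n => (hdist n).le)⟩

lemma ofReal_apply_le_add_edist (f g : C(I, ℝ)) (t : I) :
    ENNReal.ofReal (f t) ≤ ENNReal.ofReal (g t) + edist f g := by
  rw [edist_dist]
  refine le_trans (ENNReal.ofReal_le_ofReal ?_) ENNReal.ofReal_add_le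
  linarith [(abs_le.1 (ContinuousMap.dist_apply_le_dist (f := f) (g := g) t)).2]

variable {m β B τ : ℝ≥0} {G H : ℕ → ℝ≥0 → ℝ≥0∞}

lemma exists_luxemburg_le_mul_of_le_add (𝕜 : Type*) [RCLike 𝕜] (hm : 0 < m)
    (hG : ∀ n, Monotone (G n)) (hH : ∀ n, HasLowerType m (H n)) (hβ : 0 < β)
    {D : ℝ≥0∞} (hD : D ≠ ∞) {ε : ℕ → ℝ≥0∞} (hε : ∑' n, ε n ≠ ∞)
    (hle : ∀ n x, G n x < 1 → H n (β * x) ≤ D * G n x + ε n) :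
    ∃ C : ℝ≥0, ∀ a : ℕ → 𝕜, luxemburg H Measure.count a ≤ C * luxemburg G Measure.count a := by
  obtain ⟨C, hC⟩ := exists_luxemburg_le_mul 𝕜 hm (ae_of_all Measure.count hH) hβ
    (ENNReal.add_ne_top.2 ⟨hD, hε⟩)
  refine ⟨C, fun a => hC a _ fun t ht => ?_⟩
  have hsum := modular_lt_one_of_luxemburg_lt (ae_of_all _ hG) ht
  rw [modular_count] at hsum ⊢
  calc ∑' n, H n (β * (‖a n‖₊ / t)) ≤ ∑' n, (D * G n (‖a n‖₊ / t) + ε n) :=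
        ENNReal.tsum_le_tsum fun n => hle n _ ((ENNReal.le_tsum n).trans_lt hsum)
    _ = D * ∑' n, G n (‖a n‖₊ / t) + ∑' n, ε n := by rw [ENNReal.tsum_add, ENNReal.tsum_mul_left]
    _ ≤ D + ∑' n, ε n := by gcongr; exact mul_le_of_le_one_right' hsum.le

variable {k : ℕ → C(I, ℝ)} {k₀ : C(I, ℝ)} {s : ℕ → ℝ≥0∞}

lemma exists_luxemburg_le_mul_luxemburg_orliczOf (𝕜 : Type*) [RCLike 𝕜] (hm : 0 < m)
    (hG : ∀ n, HasLowerType m (G n)) (hk₀ : Monotone (orliczOf k₀)) (hβ : 0 < β)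
    (hs : ∀ n, s n ≤ 1)
    (hGk : ∀ n t, G n (β * unitInterval.toNNReal t) = s n * ENNReal.ofReal (k n t))
    (hk : ∑' n, edist (k n) k₀ ≠ ∞) :
    ∃ C : ℝ≥0, ∀ a : ℕ → 𝕜, luxemburg G Measure.count a ≤
      C * luxemburg (fun _ => orliczOf k₀) Measure.count a := by
  refine exists_luxemburg_le_mul_of_le_add 𝕜 hm (fun _ => hk₀) hG hβ ENNReal.one_ne_top hk
    fun n x hx => ?_
  have hx1 : x ≤ 1 := by
    by_contra! h
    simp [orliczOf_of_one_lt k₀ h] at hx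
  obtain ⟨t, rfl⟩ := exists_toNNReal_eq hx1
  rw [orliczOf_toNNReal, hGk, one_mul]
  exact (mul_le_of_le_one_left' (hs n)).trans (ofReal_apply_le_add_edist (k n) k₀ t)

lemma exists_luxemburg_orliczOf_le_mul_luxemburg (𝕜 : Type*) [RCLike 𝕜] (hm : 0 < m)
    (hG : ∀ n, Monotone (G n)) (hk₀ : HasLowerType m (orliczOf k₀)) (hβ : 0 < β)
    (hB : ∀ n, 1 ≤ G n B) (hτ : 0 < τ) (hs : ∀ n, (τ : ℝ≥0∞) ≤ s n)
    (hGk : ∀ n t, G n (β * unitInterval.toNNReal t) = s n * ENNReal.ofReal (k n t))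
    (hk : ∑' n, edist (k n) k₀ ≠ ∞) :
    ∃ C : ℝ≥0, ∀ a : ℕ → 𝕜, luxemburg (fun _ => orliczOf k₀) Measure.count a ≤
      C * luxemburg G Measure.count a := by
  have hc : 0 < min β⁻¹ (B + 1)⁻¹ := lt_min (inv_pos.2 hβ) (by positivity)
  have hτ0 : (τ : ℝ≥0∞) ≠ 0 := ENNReal.coe_ne_zero.2 hτ.ne'
  simp_rw [edist_comm (k _)] at hk
  refine exists_luxemburg_le_mul_of_le_add 𝕜 hm hG (fun _ => hk₀) hc
    (ENNReal.inv_ne_top.2 hτ0) hk fun n x hx => ?_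
  have hxB : x ≤ B := (hG n).reflect_lt (hx.trans_le (hB n)) |>.le
  have hcx : min β⁻¹ (B + 1)⁻¹ * x ≤ 1 := by
    calc min β⁻¹ (B + 1)⁻¹ * x ≤ (B + 1)⁻¹ * (B + 1) := by
          gcongr
          exacts [min_le_right _ _, hxB.trans le_self_add]
      _ = 1 := inv_mul_cancel₀ (by positivity)
  obtain ⟨t, ht⟩ := exists_toNNReal_eq hcx
  have hβt : β * unitInterval.toNNReal t ≤ x := by
    calc β * unitInterval.toNNReal t ≤ β * (β⁻¹ * x) := by
          rw [ht]
          gcongr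
          exact min_le_left _ _
      _ = x := mul_inv_cancel_left₀ hβ.ne' x
  have hτs : 1 ≤ (τ : ℝ≥0∞)⁻¹ * s n := by
    rw [← ENNReal.inv_mul_cancel hτ0 ENNReal.coe_ne_top]
    gcongr
    exact hs n
  rw [← ht, orliczOf_toNNReal]
  refine (ofReal_apply_le_add_edist k₀ (k n) t).trans ?_
  gcongr
  calc ENNReal.ofReal (k n t) ≤ (τ : ℝ≥0∞)⁻¹ * s n * ENNReal.ofReal (k n t) :=
        le_mul_of_one_le_left' hτs
    _ = (τ : ℝ≥0∞)⁻¹ * G n (β * unitInterval.toNNReal t) := by rw [hGk, mul_assoc]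
    _ ≤ (τ : ℝ≥0∞)⁻¹ * G n x := by gcongr; exact hG n hβt

lemma SequenceSpace.isMusielakOrlicz_iff_orliczOf {𝕜 : Type*} [RCLike 𝕜] {S : SequenceSpace 𝕜}
    (hm : 0 < m) (hG : ∀ n, HasLowerType m (G n)) (hk₀ : HasLowerType m (orliczOf k₀))
    (hβ : 0 < β) (hB : ∀ n, 1 ≤ G n B) (hτ : 0 < τ) (hs : ∀ n, s n ∈ Set.Icc (τ : ℝ≥0∞) 1)
    (hGk : ∀ n t, G n (β * unitInterval.toNNReal t) = s n * ENNReal.ofReal (k n t))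
    (hk : ∑' n, edist (k n) k₀ ≠ ∞) :
    S.IsMusielakOrlicz G ↔ S.IsMusielakOrlicz fun _ => orliczOf k₀ := by
  have hGle := exists_luxemburg_le_mul_luxemburg_orliczOf 𝕜 hm hG hk₀.monotone hβ
    (fun n => (hs n).2) hGk hk
  have hle := exists_luxemburg_orliczOf_le_mul_luxemburg 𝕜 hm (fun n => (hG n).monotone) hk₀ hβ hB
    hτ (fun n => (hs n).1) hGk hk
  exact ⟨fun h => h.congr hle hGle, fun h => h.congr hGle hle⟩

end Perturbation

section Means

variable {Ω : Type*} [MeasurableSpace Ω] {μ ν : Measure Ω} {P : Ω → ℝ≥0∞} {m : ℝ≥0}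

lemma exists_pos_forall_coe_le_of_expMinus_pos (h : 0 < expMinus P μ) :
    ∃ m : ℝ≥0, 0 < m ∧ ∀ p ∈ essRange P μ, (m : ℝ≥0∞) ≤ p := by
  obtain ⟨m, hm, hlt⟩ := ENNReal.lt_iff_exists_nnreal_btwn.1 h
  exact ⟨m, ENNReal.coe_pos.1 hm, fun p hp => hlt.le.trans (sInf_le hp)⟩

lemma ae_mem_essRange (hP : Measurable P) : ∀ᵐ ω ∂μ, P ω ∈ essRange P μ :=
  ae_of_ae_map hP.aemeasurable Measure.support_mem_ae

/-- The averages of `ω ↦ ψ_{P(ω)}` over the probability measures that are absolutely continuous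
with respect to `μ`. They are the elements of `𝒦(R(P))` that the modulars of functions in `L_P`
give rise to. -/
def expMeans (P : Ω → ℝ≥0∞) (μ : Measure Ω) : Set C(I, ℝ) :=
  {k | ∃ ν : Measure Ω, IsProbabilityMeasure ν ∧ ν ≪ μ ∧ ∫ ω, psi (P ω) ∂ν = k}

lemma integrable_psi_comp [IsFiniteMeasure ν] (hm : 0 < m) (hP : IsVarExponent P)
    (hmP : ∀ᵐ ω ∂ν, m ≤ P ω) : Integrable (fun ω => psi (P ω)) ν :=
  Integrable.of_bound (stronglyMeasurable_psi_comp hP).aestronglyMeasurable _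
    (hmP.mono fun _ hω => norm_psi_le hm hω)

lemma ofReal_integral_psi_apply (hint : Integrable (fun ω => psi (P ω)) ν) (t : I) :
    ENNReal.ofReal ((∫ ω, psi (P ω) ∂ν) t) = ∫⁻ ω, ENNReal.ofReal (psi (P ω) t) ∂ν := by
  have heval : (∫ ω, psi (P ω) ∂ν) t = ∫ ω, psi (P ω) t ∂ν :=
    ((ContinuousMap.evalCLM ℝ t).integral_comp_comm hint).symm
  have hintegrable_eval : Integrable (fun ω => psi (P ω) t) ν :=
    (ContinuousMap.evalCLM (M := ℝ) ℝ t).integrable_comp hint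
  rw [heval, ofReal_integral_eq_lintegral_ofReal hintegrable_eval
    (Eventually.of_forall fun ω => psi_nonneg _ t)]

lemma convex_expMeans (hm : 0 < m) (hP : IsVarExponent P) (hmP : ∀ᵐ ω ∂μ, m ≤ P ω) :
    Convex ℝ (expMeans P μ) := by
  rintro _ ⟨ν₁, _, hν₁, rfl⟩ _ ⟨ν₂, _, hν₂, rfl⟩ a b ha hb hab
  have hint₁ := integrable_psi_comp hm hP (hν₁.ae_le hmP)
  have hint₂ := integrable_psi_comp hm hP (hν₂.ae_le hmP)
  refine ⟨ENNReal.ofReal a • ν₁ + ENNReal.ofReal b • ν₂, ⟨?_⟩,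
    Measure.AbsolutelyContinuous.add_left (hν₁.smul_left _) (hν₂.smul_left _), ?_⟩
  · simp [← ENNReal.ofReal_add ha hb, hab]
  · rw [integral_add_measure (hint₁.smul_measure ENNReal.ofReal_ne_top)
      (hint₂.smul_measure ENNReal.ofReal_ne_top), integral_smul_measure, integral_smul_measure,
      ENNReal.toReal_ofReal ha, ENNReal.toReal_ofReal hb]

lemma expMeans_subset_convexPowers (hm : 0 < m) (hP : IsVarExponent P)
    (hmP : ∀ᵐ ω ∂μ, m ≤ P ω) : expMeans P μ ⊆ convexPowers (essRange P μ) := by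
  rintro _ ⟨ν, _, hν, rfl⟩
  exact (convex_convexPowers _).integral_mem isClosed_closure
    (hν.ae_le ((ae_mem_essRange hP.1).mono fun _ => psi_mem_convexPowers))
    (integrable_psi_comp hm hP (hν.ae_le hmP))

lemma psi_mem_closure_expMeans [SigmaFinite μ] {q : ℝ≥0∞} (hm : 0 < m) (hP : IsVarExponent P)
    (hmP : ∀ᵐ ω ∂μ, m ≤ P ω) (hq0 : 0 < q) (hq : q ∈ essRange P μ) :
    psi q ∈ closure (expMeans P μ) := by
  refine Metric.mem_closure_iff.2 fun ε hε => ?_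
  obtain ⟨V, hV, hVopen, hqV⟩ := mem_nhds_iff.1
    (continuousAt_psi hq0 (Metric.closedBall_mem_nhds _ (half_pos hε)))
  have hpos : 0 < μ (P ⁻¹' V) := by
    rw [← Measure.map_apply hP.1 hVopen.measurableSet]
    exact (Measure.mem_support_iff_forall q).1 hq V (hVopen.mem_nhds hqV)
  obtain ⟨D, hD, hDV, hD0, hDtop⟩ :=
    Measure.exists_subset_measure_lt_top (hP.1 hVopen.measurableSet) hpos
  have hDfin : μ D ≠ ∞ := hDtop.ne
  have hprob : IsProbabilityMeasure (ProbabilityTheory.cond μ D) :=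
    ProbabilityTheory.cond_isProbabilityMeasure_of_finite hD0.ne' hDfin
  have hac : ProbabilityTheory.cond μ D ≪ μ := ProbabilityTheory.cond_absolutelyContinuous
  refine ⟨_, ⟨ProbabilityTheory.cond μ D, hprob, hac, rfl⟩, ?_⟩
  have hclose : ∀ᵐ ω ∂ProbabilityTheory.cond μ D, ‖psi (P ω) - psi q‖ ≤ ε / 2 := by
    refine (ProbabilityTheory.ae_cond_mem hD).mono fun ω hω => ?_
    rw [← dist_eq_norm]
    exact hV (hDV hω)
  have hint := integrable_psi_comp hm hP (hac.ae_le hmP)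
  rw [dist_comm, dist_eq_norm]
  calc ‖(∫ ω, psi (P ω) ∂ProbabilityTheory.cond μ D) - psi q‖
      = ‖∫ ω, (psi (P ω) - psi q) ∂ProbabilityTheory.cond μ D‖ := by
        rw [integral_sub hint (integrable_const _)]
        simp
    _ ≤ ε / 2 := by simpa using norm_integral_le_of_norm_le_const hclose
    _ < ε := half_lt_self hε

lemma convexPowers_subset_closure_expMeans [SigmaFinite μ] {R : Set ℝ≥0∞} (hm : 0 < m)
    (hP : IsVarExponent P) (hmP : ∀ᵐ ω ∂μ, m ≤ P ω) (hR : ∀ p ∈ R, (m : ℝ≥0∞) ≤ p)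
    (hRP : R ⊆ essRange P μ) : convexPowers R ⊆ closure (expMeans P μ) := by
  refine closure_minimal (convexHull_min ?_ (convex_expMeans hm hP hmP).closure) isClosed_closure
  rintro _ ⟨p, hp, rfl⟩
  exact psi_mem_closure_expMeans hm hP hmP ((ENNReal.coe_pos.2 hm).trans_le (hR p hp)) (hRP hp)

end Means

section Density

variable {Ω : Type*} [MeasurableSpace Ω] {μ : Measure Ω} {P : Ω → ℝ≥0∞} {f : Ω → ℝ≥0}
  {m : ℝ≥0} {p : ℝ≥0∞}

/-- The density `p e^{-p} Φ_p(f)`, where `p = P(ω)`, with respect to which the modular of the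
dilation of `f` by `t / e` is the integral of `ψ_p(t)`. It vanishes where `P = ∞`. -/
noncomputable def expDensity (P : Ω → ℝ≥0∞) (f : Ω → ℝ≥0) (ω : Ω) : ℝ≥0∞ :=
  ENNReal.ofReal ((P ω).toReal * Real.exp (-(P ω).toReal)) * powerFn (P ω) (f ω)

lemma measurable_expDensity (hP : Measurable P) (hf : Measurable f) :
    Measurable (expDensity P f) := by
  have hpow := measurable_powerFn hP hf
  unfold expDensity
  fun_prop

lemma lintegral_expDensity_le (P : Ω → ℝ≥0∞) (f : Ω → ℝ≥0) (μ : Measure Ω) :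
    ∫⁻ ω, expDensity P f ω ∂μ ≤ modular (expMO P) μ f := by
  refine lintegral_mono fun ω => mul_le_of_le_one_left' (ENNReal.ofReal_le_one.2 ?_)
  rw [Real.exp_neg, ← div_eq_mul_inv, div_le_one (Real.exp_pos _)]
  linarith [Real.add_one_le_exp (P ω).toReal]

lemma powerFn_exp_neg_one_mul (hp : 0 < p) {x : ℝ≥0} (hx : powerFn p x ≠ ∞) (t : I) :
    powerFn p ((Real.exp (-1)).toNNReal * unitInterval.toNNReal t * x) =
      ENNReal.ofReal (psi p t) *
        (ENNReal.ofReal (p.toReal * Real.exp (-p.toReal)) * powerFn p x) := by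
  by_cases h : p = ∞
  · have hx1 : x ≤ 1 := by
      by_contra hx1
      simp [h, powerFn_top, hx1] at hx
    have hexp : (Real.exp (-1)).toNNReal ≤ 1 :=
      Real.toNNReal_le_one.2 (Real.exp_le_one_iff.2 (by norm_num))
    have ht : unitInterval.toNNReal t ≤ 1 := t.2.2
    rw [h, powerFn_top, if_pos (mul_le_one' (mul_le_one' hexp ht) hx1), psi_top]
    simp
  · have hp' := ENNReal.toReal_pos hp.ne' h
    have hψ : 0 ≤ (t : ℝ) ^ p.toReal / p.toReal := div_nonneg (Real.rpow_nonneg t.2.1 _) hp'.le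
    have hfactor : (((Real.exp (-1)).toNNReal * unitInterval.toNNReal t : ℝ≥0) : ℝ≥0∞) ^ p.toReal =
        ENNReal.ofReal (((t : ℝ) ^ p.toReal / p.toReal) * (p.toReal * Real.exp (-p.toReal))) := by
      rw [← ENNReal.coe_rpow_of_nonneg _ hp'.le, ENNReal.ofReal, ENNReal.coe_inj]
      refine NNReal.eq ?_
      rw [Real.coe_toNNReal _ (by positivity), NNReal.coe_rpow, NNReal.coe_mul,
        unitInterval.coe_toNNReal, Real.coe_toNNReal _ (Real.exp_pos _).le,
        Real.mul_rpow (Real.exp_pos _).le t.2.1, ← Real.exp_mul, neg_one_mul]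
      field_simp
    rw [powerFn_of_ne_top h, powerFn_of_ne_top h, psi_of_ne_top h, ENNReal.coe_mul,
      ENNReal.mul_rpow_of_nonneg _ _ hp'.le, hfactor, ENNReal.ofReal_mul hψ, mul_assoc]

lemma modularDilation_exp_neg_one_mul (hP : IsVarExponent P) (hf : Measurable f)
    (hfin : modular (expMO P) μ f ≠ ∞) (t : I) :
    modularDilation (expMO P) μ f ((Real.exp (-1)).toNNReal * unitInterval.toNNReal t) =
      ∫⁻ ω, ENNReal.ofReal (psi (P ω) t) * expDensity P f ω ∂μ := by
  refine lintegral_congr_ae ?_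
  filter_upwards [ae_lt_top (measurable_powerFn hP.1 hf) hfin] with ω hω
  exact powerFn_exp_neg_one_mul (hP.2 ω) hω.ne t

lemma exists_lintegral_psi_mul_eq (hm : 0 < m) (hP : IsVarExponent P) (hmP : ∀ᵐ ω ∂μ, m ≤ P ω)
    {q : Ω → ℝ≥0∞} (hq : Measurable q) (hq0 : ∫⁻ ω, q ω ∂μ ≠ 0) (hqtop : ∫⁻ ω, q ω ∂μ ≠ ∞) :
    ∃ k ∈ convexPowers (essRange P μ), ∀ t : I,
      ∫⁻ ω, ENNReal.ofReal (psi (P ω) t) * q ω ∂μ =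
        (∫⁻ ω, q ω ∂μ) * ENNReal.ofReal (k t) := by
  have hmass : μ.withDensity q Set.univ = ∫⁻ ω, q ω ∂μ := by
    rw [withDensity_apply _ .univ, setLIntegral_univ]
  have hprob : IsProbabilityMeasure ((∫⁻ ω, q ω ∂μ)⁻¹ • μ.withDensity q) :=
    ⟨by rw [Measure.smul_apply, hmass, smul_eq_mul, ENNReal.inv_mul_cancel hq0 hqtop]⟩
  have hac : (∫⁻ ω, q ω ∂μ)⁻¹ • μ.withDensity q ≪ μ :=
    (withDensity_absolutelyContinuous μ q).smul_left _
  refine ⟨_, expMeans_subset_convexPowers hm hP hmP ⟨_, hprob, hac, rfl⟩, fun t => ?_⟩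
  have hψ : Measurable fun ω => ENNReal.ofReal (psi (P ω) t) :=
    ((continuous_eval_const t).comp_stronglyMeasurable
      (stronglyMeasurable_psi_comp hP)).measurable.ennreal_ofReal
  rw [ofReal_integral_psi_apply (integrable_psi_comp hm hP (hac.ae_le hmP)),
    lintegral_smul_measure, smul_eq_mul, ENNReal.mul_inv_cancel_left hq0 hqtop,
    lintegral_withDensity_eq_lintegral_mul _ hq hψ]
  simp only [Pi.mul_apply, mul_comm]

lemma exists_lintegral_psi_mul_eq_of_top_mem (hm : 0 < m) (hP : IsVarExponent P)
    (hmP : ∀ᵐ ω ∂μ, m ≤ P ω) (htop : ∞ ∈ essRange P μ) {q : Ω → ℝ≥0∞} (hq : Measurable q)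
    (hq1 : ∫⁻ ω, q ω ∂μ ≤ 1) :
    ∃ k ∈ convexPowers (essRange P μ), ∀ t : I,
      ∫⁻ ω, ENNReal.ofReal (psi (P ω) t) * q ω ∂μ = ENNReal.ofReal (k t) := by
  have hzero : (0 : C(I, ℝ)) ∈ convexPowers (essRange P μ) := psi_top ▸ psi_mem_convexPowers htop
  have hqtop : ∫⁻ ω, q ω ∂μ ≠ ∞ := ne_top_of_le_ne_top ENNReal.one_ne_top hq1
  by_cases hq0 : ∫⁻ ω, q ω ∂μ = 0
  · refine ⟨0, hzero, fun t => ?_⟩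
    rw [ContinuousMap.zero_apply, ENNReal.ofReal_zero]
    refine lintegral_eq_zero_of_ae_eq_zero ?_
    filter_upwards [(lintegral_eq_zero_iff hq).1 hq0] with ω hω
    simp [hω]
  · obtain ⟨k, hk, hkq⟩ := exists_lintegral_psi_mul_eq hm hP hmP hq hq0 hqtop
    refine ⟨(∫⁻ ω, q ω ∂μ).toReal • k, (convex_convexPowers _).smul_mem_of_zero_mem hzero hk
      ⟨ENNReal.toReal_nonneg, ENNReal.toReal_le_of_le_ofReal zero_le_one (by simpa using hq1)⟩,
      fun t => ?_⟩
    rw [hkq, ContinuousMap.smul_apply, smul_eq_mul, ENNReal.ofReal_mul ENNReal.toReal_nonneg,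
      ENNReal.ofReal_toReal hqtop]

lemma exists_forall_le_coe_of_top_notMem (htop : ∞ ∉ essRange P μ) :
    ∃ Q : ℝ≥0, ∀ p ∈ essRange P μ, p ≤ Q := by
  obtain ⟨Q, hQ, hQsub⟩ := ENNReal.nhds_top_basis.mem_iff.1
    ((Measure.isClosed_support (μ := μ.map P)).isOpen_compl.mem_nhds htop)
  lift Q to ℝ≥0 using hQ.ne
  exact ⟨Q, fun p hp => not_lt.1 fun h => hQsub h hp⟩

lemma mul_powerFn_mul_le {Q C : ℝ≥0} (hm : 0 < m) (hmp : m ≤ p) (hpQ : p ≤ Q) (hC : 1 ≤ C)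
    (x : ℝ≥0) :
    ENNReal.ofReal (m * Real.exp (-Q) / (C : ℝ) ^ (Q : ℝ)) * powerFn p (C * x) ≤
      ENNReal.ofReal (p.toReal * Real.exp (-p.toReal)) * powerFn p x := by
  have hptop : p ≠ ∞ := ne_top_of_le_ne_top ENNReal.coe_ne_top hpQ
  have hmp' : (m : ℝ) ≤ p.toReal := by simpa using ENNReal.toReal_mono hptop hmp
  have hpQ' : p.toReal ≤ Q := ENNReal.toReal_le_coe_of_le_coe hpQ
  have hCpow : (C : ℝ≥0∞) ^ p.toReal = ENNReal.ofReal ((C : ℝ) ^ p.toReal) := by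
    rw [← ENNReal.ofReal_rpow_of_nonneg C.coe_nonneg ENNReal.toReal_nonneg,
      ENNReal.ofReal_coe_nnreal]
  have : (0 : ℝ) < C := one_pos.trans_le hC
  rw [powerFn_of_ne_top hptop, powerFn_of_ne_top hptop, ENNReal.coe_mul,
    ENNReal.mul_rpow_of_nonneg _ _ ENNReal.toReal_nonneg, ← mul_assoc, hCpow,
    ← ENNReal.ofReal_mul (by positivity)]
  refine mul_le_mul_left (ENNReal.ofReal_le_ofReal ?_) _
  rw [div_mul_eq_mul_div, div_le_iff₀ (by positivity)]
  have hC1 : (1 : ℝ) ≤ C := hC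
  gcongr

lemma le_lintegral_expDensity {Q C : ℝ≥0} (hm : 0 < m) (hmP : ∀ᵐ ω ∂μ, m ≤ P ω)
    (hPQ : ∀ᵐ ω ∂μ, P ω ≤ Q) (hC : 1 ≤ C) (hfC : 1 ≤ modularDilation (expMO P) μ f C) :
    ENNReal.ofReal (m * Real.exp (-Q) / (C : ℝ) ^ (Q : ℝ)) ≤ ∫⁻ ω, expDensity P f ω ∂μ := by
  set τ := ENNReal.ofReal (m * Real.exp (-Q) / (C : ℝ) ^ (Q : ℝ))
  calc τ ≤ τ * modularDilation (expMO P) μ f C := le_mul_of_one_le_right' hfC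
    _ = ∫⁻ ω, τ * powerFn (P ω) (C * f ω) ∂μ :=
        (lintegral_const_mul' _ _ ENNReal.ofReal_ne_top).symm
    _ ≤ ∫⁻ ω, expDensity P f ω ∂μ := by
        refine lintegral_mono_ae ?_
        filter_upwards [hmP, hPQ] with ω hmω hωQ
        exact mul_powerFn_mul_le hm hmω hωQ hC (f ω)

lemma exists_modularDilation_eq_mul_convexPowers (hm : 0 < m) (hP : IsVarExponent P)
    (hmP : ∀ᵐ ω ∂μ, m ≤ P ω) {C : ℝ≥0} (hC : 1 ≤ C) :
    ∃ τ : ℝ≥0, 0 < τ ∧ ∀ f : Ω → ℝ≥0, Measurable f → modular (expMO P) μ f ≤ 1 →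
      1 ≤ modularDilation (expMO P) μ f C →
      ∃ s ∈ Set.Icc (τ : ℝ≥0∞) 1, ∃ k ∈ convexPowers (essRange P μ), ∀ t : I,
        modularDilation (expMO P) μ f ((Real.exp (-1)).toNNReal * unitInterval.toNNReal t) =
          s * ENNReal.ofReal (k t) := by
  have hfin {f : Ω → ℝ≥0} (hf1 : modular (expMO P) μ f ≤ 1) : modular (expMO P) μ f ≠ ∞ :=
    ne_top_of_le_ne_top ENNReal.one_ne_top hf1
  by_cases htop : ∞ ∈ essRange P μ
  · refine ⟨1, one_pos, fun f hf hf1 _ => ⟨1, by simp, ?_⟩⟩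
    obtain ⟨k, hk, hkf⟩ := exists_lintegral_psi_mul_eq_of_top_mem hm hP hmP htop
      (measurable_expDensity hP.1 hf) ((lintegral_expDensity_le P f μ).trans hf1)
    exact ⟨k, hk, fun t => by
      rw [modularDilation_exp_neg_one_mul hP hf (hfin hf1), hkf, one_mul]⟩
  · obtain ⟨Q, hQ⟩ := exists_forall_le_coe_of_top_notMem htop
    have hτ : 0 < (m * Real.exp (-Q) / (C : ℝ) ^ (Q : ℝ)).toNNReal :=
      Real.toNNReal_pos.2 (by positivity)
    refine ⟨_, hτ, fun f hf hf1 hfC => ⟨∫⁻ ω, expDensity P f ω ∂μ, ?_⟩⟩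
    have hle := (lintegral_expDensity_le P f μ).trans hf1
    have hge := le_lintegral_expDensity hm hmP ((ae_mem_essRange hP.1).mono fun _ => hQ _) hC hfC
    obtain ⟨k, hk, hkf⟩ := exists_lintegral_psi_mul_eq hm hP hmP (measurable_expDensity hP.1 hf)
      ((ENNReal.coe_pos.2 hτ).trans_le hge).ne' (ne_top_of_le_ne_top ENNReal.one_ne_top hle)
    exact ⟨⟨hge, hle⟩, k, hk, fun t => by
      rw [modularDilation_exp_neg_one_mul hP hf (hfin hf1), hkf]⟩

end Density

namespace SequenceSpace

variable {𝕜 : Type*} [RCLike 𝕜] {S : SequenceSpace 𝕜} {Ω : Type*} [MeasurableSpace Ω]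
  {μ : Measure Ω} {P : Ω → ℝ≥0∞} {m : ℝ≥0}

lemma IsMusielakOrlicz.exists_forall_modularDilation_eq {f : ℕ → Ω → ℝ≥0}
    (hSf : S.IsMusielakOrlicz fun n => modularDilation (expMO P) μ (f n)) (hS : S.IsSubsymmetric)
    (hm : 0 < m) (hP : IsVarExponent P) (hmP : ∀ᵐ ω ∂μ, m ≤ P ω) (hf : ∀ n, Measurable (f n)) :
    ∃ β B τ : ℝ≥0, 0 < β ∧ 0 < τ ∧ (∀ n, 1 ≤ modularDilation (expMO P) μ (f n) B) ∧
      ∀ n, ∃ s ∈ Set.Icc (τ : ℝ≥0∞) 1, ∃ k ∈ convexPowers (essRange P μ), ∀ t : I,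
        modularDilation (expMO P) μ (f n) (β * unitInterval.toNNReal t) =
          s * ENNReal.ofReal (k t) := by
  have hlower : ∀ n, HasLowerType m (modularDilation (expMO P) μ (f n)) := fun n =>
    hasLowerType_modularDilation (hmP.mono fun _ => hasLowerType_powerFn) _
  have hzero : ∀ n, modularDilation (expMO P) μ (f n) 0 = 0 := fun n => (hlower n).map_zero hm
  obtain ⟨b, hb0, hb⟩ := hSf.exists_pos_forall_le_one hS (fun n => (hlower n).monotone) hzero
  obtain ⟨B, hB⟩ := hSf.exists_forall_one_le hS hzero
  obtain ⟨τ, hτ, hconv⟩ := exists_modularDilation_eq_mul_convexPowers hm hP hmP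
    (C := max 1 (B / b)) (le_max_left _ _)
  have hdilate : ∀ n t, modularDilation (expMO P) μ (fun ω => b * f n ω) t =
      modularDilation (expMO P) μ (f n) (b * t) := fun n t => by
    simp only [modularDilation, ← mul_assoc, mul_comm t b]
  refine ⟨b * (Real.exp (-1)).toNNReal, B, τ,
    mul_pos hb0 (Real.toNNReal_pos.2 (Real.exp_pos _)), hτ, hB, fun n => ?_⟩
  have hBb : B ≤ b * max 1 (B / b) := by
    rw [← div_le_iff₀' hb0]
    exact le_max_right _ _
  simpa only [hdilate, ← mul_assoc] using hconv (fun ω => b * f n ω) ((hf n).const_mul b) (hb n)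
    ((hB n).trans (((hlower n).monotone hBb).trans_eq (hdilate n _).symm))

theorem DisjointlyEmbeds.exists_orliczGen (hT : S.DisjointlyEmbeds μ P) (hS : S.IsSubsymmetric)
    (hm : 0 < m) (hP : IsVarExponent P) (hR : ∀ p ∈ essRange P μ, (m : ℝ≥0∞) ≤ p) :
    ∃ F, OrliczGen (essRange P μ) F ∧ S.EqOrliczSpace F := by
  have hmP : ∀ᵐ ω ∂μ, m ≤ P ω := (ae_mem_essRange hP.1).mono fun _ => hR _
  obtain ⟨f, hf, hSf⟩ := hT.exists_isMusielakOrlicz hm hP hmP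
  obtain ⟨β, B, τ, hβ, hτ, hB, hsk⟩ := hSf.exists_forall_modularDilation_eq hS hm hP hmP hf
  choose s hs k hk hGk using hsk
  obtain ⟨k₀, hk₀, π, hπ, hsum⟩ := exists_strictMono_tsum_edist_ne_top
    (isCompact_convexPowers hm hR) hk
  have hlower : ∀ n, HasLowerType m (modularDilation (expMO P) μ (f n)) := fun n =>
    hasLowerType_modularDilation (hmP.mono fun _ => hasLowerType_powerFn) _
  have hlower₀ := hasLowerType_orliczOf hm hR hk₀
  have hSk₀ : S.IsMusielakOrlicz fun _ => orliczOf k₀ :=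
    (isMusielakOrlicz_iff_orliczOf hm (fun n => hlower (π n)) hlower₀ hβ (fun n => hB (π n)) hτ
      (fun n => hs (π n)) (fun n => hGk (π n)) hsum).1
      (hSf.comp_strictMono hS (fun n => (hlower n).map_zero hm) hπ)
  exact ⟨orliczOf k₀, orliczGen_orliczOf hm hR hk₀, hSk₀.eqOrliczSpace hm hlower₀⟩

end SequenceSpace

section EquivalentNearZero

variable {F H : ℝ≥0 → ℝ≥0∞} {c A B m : ℝ≥0}

lemma IsOrlicz.exists_forall_tsum_lt_one (hF : IsOrlicz F) (hc : 0 < c) (hA : 0 < A)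
    (hHF : ∀ t ≤ c, A * H t ≤ F t) :
    ∃ ε d : ℝ≥0, 0 < ε ∧ 0 < d ∧
      ∀ x : ℕ → ℝ≥0, ∑' n, F (x n) < ε → ∑' n, H (d * x n) < 1 := by
  obtain ⟨L, hL, hlim⟩ := hF.top_pos
  obtain ⟨t₀, hFt₀, ht₀⟩ := ((hlim.eventually_const_lt hL).and (eventually_gt_atTop 0)).exists
  obtain ⟨ε, hε, hεle⟩ := ENNReal.lt_iff_exists_nnreal_btwn.1
    (lt_min hFt₀ (ENNReal.coe_pos.2 hA))
  refine ⟨ε, min 1 (c / t₀), ENNReal.coe_pos.1 hε, by positivity, fun x hx => ?_⟩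
  have hx_lt : ∀ n, x n < t₀ := fun n => hF.mono.reflect_lt
    ((ENNReal.le_tsum n).trans_lt (hx.trans (hεle.trans_le (min_le_left _ _))))
  have hdx : ∀ n, min 1 (c / t₀) * x n ≤ c := fun n => by
    calc min 1 (c / t₀) * x n ≤ c / t₀ * t₀ :=
          mul_le_mul' (min_le_right _ _) (hx_lt n).le
      _ = c := div_mul_cancel₀ _ ht₀.ne'
  have hsum : A * ∑' n, H (min 1 (c / t₀) * x n) < A * 1 := by
    calc A * ∑' n, H (min 1 (c / t₀) * x n) = ∑' n, A * H (min 1 (c / t₀) * x n) :=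
          ENNReal.tsum_mul_left.symm
      _ ≤ ∑' n, F (x n) := ENNReal.tsum_le_tsum fun n =>
          (hHF _ (hdx n)).trans (hF.mono (mul_le_of_le_one_left' (min_le_left _ _)))
      _ < A * 1 := by
          rw [mul_one]
          exact hx.trans (hεle.trans_le (min_le_right _ _))
  exact lt_of_mul_lt_mul_left' hsum

lemma HasLowerType.exists_forall_tsum_lt (hH : HasLowerType m H) (hm : 0 < m) (hc : 0 < c)
    (hc1 : c ≤ 1) (hH1 : ∀ t, 1 < t → 1 ≤ H t) (hFH : ∀ t ≤ c, F t ≤ B * H t) {ε : ℝ≥0}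
    (hε : 0 < ε) :
    ∃ d : ℝ≥0, 0 < d ∧ ∀ x : ℕ → ℝ≥0, ∑' n, H (x n) < 1 → ∑' n, F (d * x n) < ε := by
  obtain ⟨s, hs0, hs1, hs⟩ := exists_coe_rpow_mul_lt hm (ENNReal.coe_ne_top (r := B))
    (ENNReal.coe_pos.2 hε)
  refine ⟨s * c, mul_pos hs0 hc, fun x hx => ?_⟩
  have hx1 : ∀ n, x n ≤ 1 := fun n => not_lt.1 fun h =>
    (((ENNReal.le_tsum n).trans_lt hx).trans_le (hH1 _ h)).false
  have hterm : ∀ n, F (s * c * x n) ≤ (s : ℝ≥0∞) ^ (m : ℝ) * B * H (x n) := fun n => by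
    calc F (s * c * x n) ≤ B * H (s * c * x n) := hFH _ (by
          rw [mul_right_comm]
          exact mul_le_of_le_one_left' (mul_le_one' hs1 (hx1 n)))
      _ ≤ B * ((s : ℝ≥0∞) ^ (m : ℝ) * H (c * x n)) := by
          rw [mul_assoc s]
          gcongr
          exact hH s _ hs1
      _ ≤ B * ((s : ℝ≥0∞) ^ (m : ℝ) * H (x n)) := by
          gcongr
          exact hH.monotone (mul_le_of_le_one_left' hc1)
      _ = (s : ℝ≥0∞) ^ (m : ℝ) * B * H (x n) := by ring
  calc ∑' n, F (s * c * x n) ≤ (s : ℝ≥0∞) ^ (m : ℝ) * B * ∑' n, H (x n) :=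
        (ENNReal.tsum_le_tsum hterm).trans_eq ENNReal.tsum_mul_left
    _ ≤ (s : ℝ≥0∞) ^ (m : ℝ) * B := mul_le_of_le_one_right' hx.le
    _ < ε := hs

lemma OrliczGen.exists_equiv_orliczOf {R : Set ℝ≥0∞} (hF : OrliczGen R F) :
    ∃ k ∈ convexPowers R, ∃ c A B : ℝ≥0, 0 < c ∧ c ≤ 1 ∧ 0 < A ∧
      ∀ t ≤ c, A * orliczOf k t ≤ F t ∧ F t ≤ B * orliczOf k t := by
  obtain ⟨-, c, hc, hc1, k, hk, A, B, hA, hB, hFk⟩ := hF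
  refine ⟨k, hk, c.toNNReal, A.toNNReal, B.toNNReal, Real.toNNReal_pos.2 hc,
    Real.toNNReal_le_one.2 hc1, Real.toNNReal_pos.2 hA, fun t ht => ?_⟩
  obtain ⟨u, rfl⟩ := exists_toNNReal_eq (ht.trans (Real.toNNReal_le_one.2 hc1))
  have hu : (u : ℝ) ≤ c := by
    simpa using (Real.le_toNNReal_iff_coe_le hc.le).1 ht
  rw [orliczOf_toNNReal]
  change ENNReal.ofReal A * _ ≤ _ ∧ _ ≤ ENNReal.ofReal B * _
  rw [← ENNReal.ofReal_mul hA.le, ← ENNReal.ofReal_mul hB.le]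
  exact hFk u hu

lemma SequenceSpace.EqOrliczSpace.exists_isMusielakOrlicz_orliczOf {𝕜 : Type*} [RCLike 𝕜]
    {S : SequenceSpace 𝕜} {R : Set ℝ≥0∞} (hS : S.EqOrliczSpace F) (hm : 0 < m)
    (hR : ∀ p ∈ R, (m : ℝ≥0∞) ≤ p) (hF : OrliczGen R F) :
    ∃ k ∈ convexPowers R, S.IsMusielakOrlicz fun _ => orliczOf k := by
  obtain ⟨k, hk, c, A, B, hc, hc1, hA, hFk⟩ := hF.exists_equiv_orliczOf
  have hlower := hasLowerType_orliczOf hm hR hk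
  obtain ⟨ε, d, hε, hd, hkF⟩ := hF.1.exists_forall_tsum_lt_one hc hA fun t ht => (hFk t ht).1
  refine ⟨k, hk, hS.exists_luxemburg_le_mul_nrm hε hd hkF,
    hS.exists_nrm_le_mul_luxemburg hlower.monotone fun ε hε => ?_⟩
  exact hlower.exists_forall_tsum_lt hm hc hc1
    (fun t ht => (orliczOf_of_one_lt k ht).symm ▸ le_top) (fun t ht => (hFk t ht).2) hε

end EquivalentNearZero

section Root

variable {Ω : Type*} [MeasurableSpace Ω] {μ : Measure Ω} {P : Ω → ℝ≥0∞} {m : ℝ≥0} {p : ℝ≥0∞}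
  {k : C(I, ℝ)}

/-- The solution `x = (y / p)^{1/p}` of `Φ_p(t x) = ψ_p(t) y` for `t ∈ [0,1]`. For `p = ∞` every
`x ≤ 1` is a solution, and the largest one is taken. -/
noncomputable def psiRoot (p : ℝ≥0∞) (y : ℝ≥0) : ℝ≥0 :=
  if p = ∞ then 1 else (y / p.toNNReal) ^ p.toReal⁻¹

lemma measurable_psiRoot {h : Ω → ℝ≥0} (hP : Measurable P) (hh : Measurable h) :
    Measurable fun ω => psiRoot (P ω) (h ω) :=
  Measurable.ite (hP (measurableSet_singleton _)) measurable_const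
    ((hh.div hP.ennreal_toNNReal).pow hP.ennreal_toReal.inv)

lemma powerFn_mul_psiRoot (hp : 0 < p) (hptop : p ≠ ∞) (y t : ℝ≥0) :
    powerFn p (t * psiRoot p y) = ENNReal.ofReal ((t : ℝ) ^ p.toReal / p.toReal) * y := by
  have hp' : 0 < p.toReal := ENNReal.toReal_pos hp.ne' hptop
  rw [powerFn_of_ne_top hptop, psiRoot, if_neg hptop, ← ENNReal.coe_rpow_of_nonneg _ hp'.le,
    NNReal.mul_rpow, ← NNReal.rpow_mul, inv_mul_cancel₀ hp'.ne', NNReal.rpow_one, ENNReal.ofReal,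
    ← ENNReal.coe_mul, ENNReal.coe_inj]
  refine NNReal.eq ?_
  rw [NNReal.coe_mul, NNReal.coe_mul, NNReal.coe_rpow, NNReal.coe_div,
    ENNReal.coe_toNNReal_eq_toReal, Real.coe_toNNReal _ (by positivity)]
  ring

lemma powerFn_toNNReal_mul_psiRoot (hp : 0 < p) (y : ℝ≥0) (t : I) :
    powerFn p (unitInterval.toNNReal t * psiRoot p y) = ENNReal.ofReal (psi p t) * y := by
  by_cases hptop : p = ∞
  · have ht : unitInterval.toNNReal t ≤ 1 := t.2.2
    simp [hptop, psiRoot, powerFn_top, psi_top, ht]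
  · rw [powerFn_mul_psiRoot hp hptop, psi_of_ne_top hptop, unitInterval.coe_toNNReal]

lemma le_powerFn_exp_one_mul_psiRoot (hp : 0 < p) (y : ℝ≥0) :
    y ≤ powerFn p ((Real.exp 1).toNNReal * psiRoot p y) := by
  by_cases hptop : p = ∞
  · have hexp : ¬ (Real.exp 1).toNNReal ≤ 1 := by simp
    simp [hptop, psiRoot, powerFn_top, hexp]
  · have hp' : 0 < p.toReal := ENNReal.toReal_pos hp.ne' hptop
    rw [powerFn_mul_psiRoot hp hptop, Real.coe_toNNReal _ (Real.exp_pos _).le, ← Real.exp_mul,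
      one_mul]
    refine le_mul_of_one_le_left' (ENNReal.one_le_ofReal.2 ((one_le_div hp').2 ?_))
    linarith [Real.add_one_le_exp p.toReal]

lemma exists_modularDilation_eq_of_mem_expMeans [SigmaFinite μ] (hm : 0 < m)
    (hP : IsVarExponent P) (hmP : ∀ᵐ ω ∂μ, m ≤ P ω) (hk : k ∈ expMeans P μ) :
    ∃ g : Ω → ℝ≥0, Measurable g ∧ 1 ≤ modularDilation (expMO P) μ g (Real.exp 1).toNNReal ∧
      ∀ t : I, modularDilation (expMO P) μ g (unitInterval.toNNReal t) =
        ENNReal.ofReal (k t) := by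
  obtain ⟨ν, _, hν, rfl⟩ := hk
  have hdensity : ∀ᵐ ω ∂μ, ((ν.rnDeriv μ ω).toNNReal : ℝ≥0∞) = ν.rnDeriv μ ω :=
    (Measure.rnDeriv_ne_top ν μ).mono fun _ => ENNReal.coe_toNNReal
  refine ⟨fun ω => psiRoot (P ω) (ν.rnDeriv μ ω).toNNReal,
    measurable_psiRoot hP.1 (Measure.measurable_rnDeriv ν μ).ennreal_toNNReal, ?_, fun t => ?_⟩
  · calc 1 = ∫⁻ ω, ν.rnDeriv μ ω ∂μ := by rw [Measure.lintegral_rnDeriv hν, measure_univ]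
      _ ≤ _ := lintegral_mono_ae (hdensity.mono fun ω hω =>
          hω ▸ le_powerFn_exp_one_mul_psiRoot (hP.2 ω) _)
  · have hψ : Measurable fun ω => ENNReal.ofReal (psi (P ω) t) :=
      ((continuous_eval_const t).comp_stronglyMeasurable
        (stronglyMeasurable_psi_comp hP)).measurable.ennreal_ofReal
    rw [ofReal_integral_psi_apply (integrable_psi_comp hm hP (hν.ae_le hmP)),
      ← lintegral_rnDeriv_mul hν hψ.aemeasurable]
    refine lintegral_congr_ae (hdensity.mono fun ω hω => ?_)
    change powerFn _ _ = _
    rw [powerFn_toNNReal_mul_psiRoot (hP.2 ω), hω, mul_comm]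

lemma exists_partition_modularDilation_eq [SigmaFinite μ] (hμ : IsNonatomic μ) (hm : 0 < m)
    (hP : IsVarExponent P) (hR : ∀ p ∈ essRange P μ, (m : ℝ≥0∞) ≤ p)
    (hk : k ∈ convexPowers (essRange P μ)) {ε : ℕ → ℝ≥0∞} (hε : ∀ n, 0 < ε n) :
    ∃ (N : Ω → ℕ) (g : Ω → ℝ≥0) (l : ℕ → C(I, ℝ)), Measurable N ∧ Measurable g ∧
      (∀ n, edist (l n) k ≤ ε n) ∧ ∀ n,
        1 ≤ modularDilation (expMO P) (μ.restrict (N ⁻¹' {n})) g (Real.exp 1).toNNReal ∧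
        ∀ t : I, modularDilation (expMO P) (μ.restrict (N ⁻¹' {n})) g (unitInterval.toNNReal t) =
          ENNReal.ofReal (l n t) := by
  obtain ⟨N, hN, hNP⟩ := hμ.exists_partition_support_subset hP.1
  have hmP : ∀ n, ∀ᵐ ω ∂μ.restrict (N ⁻¹' {n}), m ≤ P ω := fun n =>
    ae_restrict_of_ae ((ae_mem_essRange hP.1).mono fun _ => hR _)
  have happrox : ∀ n, ∃ l ∈ expMeans P (μ.restrict (N ⁻¹' {n})), edist k l < ε n := fun n =>
    EMetric.mem_closure_iff.1
      (convexPowers_subset_closure_expMeans hm hP (hmP n) hR (hNP n) hk) _ (hε n)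
  choose l hl hlk using happrox
  choose g hg hg_one hgl using fun n =>
    exists_modularDilation_eq_of_mem_expMeans hm hP (hmP n) (hl n)
  have hpiece : ∀ n t, modularDilation (expMO P) (μ.restrict (N ⁻¹' {n})) (fun ω => g (N ω) ω) t =
      modularDilation (expMO P) (μ.restrict (N ⁻¹' {n})) (g n) t := fun n t =>
    setLIntegral_congr_fun (hN (measurableSet_singleton n)) fun ω (hω : N ω = n) => by
      simp only [hω]
  have hg_joint : Measurable fun x : ℕ × Ω => g x.1 x.2 := measurable_from_prod_countable_right hg
  refine ⟨N, fun ω => g (N ω) ω, l, hN, hg_joint.comp (hN.prodMk measurable_id),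
    fun n => (edist_comm _ _).trans_le (hlk n).le, fun n => ?_⟩
  simp only [hpiece]
  exact ⟨hg_one n, hgl n⟩

end Root

namespace SequenceSpace

variable {𝕜 : Type*} [RCLike 𝕜] {S : SequenceSpace 𝕜} {Ω : Type*} [MeasurableSpace Ω]
  {μ : Measure Ω} {N : Ω → ℕ} {g : Ω → ℝ≥0}

lemma stronglyMeasurable_comp_mul (a : ℕ → 𝕜) (hN : Measurable N) (hg : Measurable g) :
    StronglyMeasurable fun ω => a (N ω) * ((g ω : ℝ) : 𝕜) :=
  ((measurable_from_nat.comp hN).mul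
    (RCLike.measurable_ofReal.comp hg.coe_nnreal_real)).stronglyMeasurable

/-- The linear map that sends a sequence `a` to the function equal to `a n * g` on `{N = n}`, for
`N : Ω → ℕ`. It maps the unit vectors to disjointly supported functions. -/
noncomputable def spread (S : SequenceSpace 𝕜) (μ : Measure Ω) (hN : Measurable N)
    (hg : Measurable g) : S.carrier →ₗ[𝕜] (Ω →ₘ[μ] 𝕜) where
  toFun a := AEEqFun.mk (fun ω => (a : ℕ → 𝕜) (N ω) * ((g ω : ℝ) : 𝕜))
    (stronglyMeasurable_comp_mul _ hN hg).aestronglyMeasurable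
  map_add' a b := by
    rw [AEEqFun.mk_add_mk]
    congr 1
    ext ω
    exact add_mul _ _ _
  map_smul' c a := by
    rw [RingHom.id_apply, AEEqFun.smul_mk]
    congr 1
    ext ω
    exact mul_assoc _ _ _

lemma coeFn_spread (hN : Measurable N) (hg : Measurable g) (a : S.carrier) :
    ∀ᵐ ω ∂μ, S.spread μ hN hg a ω = (a : ℕ → 𝕜) (N ω) * ((g ω : ℝ) : 𝕜) :=
  AEEqFun.coeFn_mk _ _

lemma spread_unitVec_eq_zero_or (hN : Measurable N) (hg : Measurable g) {i j : ℕ} (hij : i ≠ j) :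
    ∀ᵐ ω ∂μ, S.spread μ hN hg (S.unitVec i) ω = 0 ∨ S.spread μ hN hg (S.unitVec j) ω = 0 := by
  filter_upwards [coeFn_spread hN hg (S.unitVec i), coeFn_spread hN hg (S.unitVec j)] with ω hi hj
  rw [hi, hj]
  rcases eq_or_ne (N ω) i with h | h
  · exact Or.inr (by simp [unitVec, h, hij])
  · exact Or.inl (by simp [unitVec, h])

lemma luxemburg_spread (M : Ω → ℝ≥0 → ℝ≥0∞) (hN : Measurable N) (hg : Measurable g)
    (a : S.carrier) :
    luxemburg M μ (S.spread μ hN hg a) =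
      luxemburg (fun n => modularDilation M (μ.restrict (N ⁻¹' {n})) g) Measure.count
        (a : ℕ → 𝕜) := by
  have hNm : ∀ n, MeasurableSet (N ⁻¹' {n}) := fun n => hN (measurableSet_singleton n)
  have hmod : ∀ t : ℝ≥0, modular M μ (fun ω => ‖S.spread μ hN hg a ω‖₊ / t) =
      modular (fun n => modularDilation M (μ.restrict (N ⁻¹' {n})) g) Measure.count
        fun n => ‖(a : ℕ → 𝕜) n‖₊ / t := fun t => by
    calc ∫⁻ ω, M ω (‖S.spread μ hN hg a ω‖₊ / t) ∂μ
        = ∫⁻ ω, M ω (‖(a : ℕ → 𝕜) (N ω)‖₊ / t * g ω) ∂μ := by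
          refine lintegral_congr_ae ((coeFn_spread hN hg a).mono fun ω hω => ?_)
          have hgω : ‖((g ω : ℝ) : 𝕜)‖₊ = g ω := nnnorm_algebraMap_nnreal 𝕜 (g ω)
          simp only [hω, nnnorm_mul, hgω, mul_div_right_comm]
      _ = ∑' n, ∫⁻ ω in N ⁻¹' {n}, M ω (‖(a : ℕ → 𝕜) (N ω)‖₊ / t * g ω) ∂μ := by
          rw [← lintegral_iUnion hNm (pairwise_disjoint_fiber N), ← Set.preimage_iUnion,
            Set.iUnion_of_singleton, Set.preimage_univ, setLIntegral_univ]
      _ = ∑' n, modularDilation M (μ.restrict (N ⁻¹' {n})) g (‖(a : ℕ → 𝕜) n‖₊ / t) :=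
          tsum_congr fun n => setLIntegral_congr_fun (hNm n) fun ω (hω : N ω = n) => by
            simp only [hω]
      _ = _ := (modular_count _ _).symm
  simp only [luxemburg, hmod]

variable {P : Ω → ℝ≥0∞} {m : ℝ≥0}

lemma IsMusielakOrlicz.disjointlyEmbeds (hm : 0 < m) (hmP : ∀ᵐ ω ∂μ, m ≤ P ω)
    (hN : Measurable N) (hg : Measurable g)
    (hS : S.IsMusielakOrlicz fun n => modularDilation (expMO P) (μ.restrict (N ⁻¹' {n})) g) :
    S.DisjointlyEmbeds μ P := by
  obtain ⟨⟨C₁, hC₁⟩, C₂, hC₂⟩ := hS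
  simp only [← luxemburg_spread (expMO P) hN hg] at hC₁
  have hfin : ∀ a : S.carrier, luxemburg (expMO P) μ (S.spread μ hN hg a) < ∞ := fun a =>
    (hC₁ a).trans_lt (ENNReal.mul_lt_top ENNReal.coe_lt_top ENNReal.coe_lt_top)
  refine ⟨S.spread μ hN hg, fun a => (memMO_iff_luxemburg_lt_top hm
    (hmP.mono fun _ => hasLowerType_powerFn)).2 (hfin a), ⟨max C₁ C₂, fun a => ⟨?_, ?_⟩⟩,
    fun _ _ => spread_unitVec_eq_zero_or hN hg⟩
  · exact (hC₁ a).trans (by gcongr; exact le_max_left _ _)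
  · obtain ⟨_, hle⟩ := hC₂ a ((luxemburg_spread _ hN hg a).symm.trans_lt (hfin a))
    rw [luxemburg_spread]
    exact hle.trans (by gcongr; exact le_max_right _ _)

theorem EqOrliczSpace.disjointlyEmbeds [SigmaFinite μ] {F : ℝ≥0 → ℝ≥0∞} (hS : S.EqOrliczSpace F)
    (hμ : IsNonatomic μ) (hm : 0 < m) (hP : IsVarExponent P)
    (hR : ∀ p ∈ essRange P μ, (m : ℝ≥0∞) ≤ p) (hF : OrliczGen (essRange P μ) F) :
    S.DisjointlyEmbeds μ P := by
  obtain ⟨k, hk, hSk⟩ := hS.exists_isMusielakOrlicz_orliczOf hm hR hF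
  obtain ⟨ε, hε, hεsum⟩ := ENNReal.exists_pos_sum_of_countable' one_ne_zero ℕ
  obtain ⟨N, g, l, hN, hg, hlk, hmod⟩ := exists_partition_modularDilation_eq hμ hm hP hR hk hε
  have hsum : ∑' n, edist (l n) k ≠ ∞ := ne_top_of_le_ne_top hεsum.ne_top (ENNReal.tsum_le_tsum hlk)
  have hmP : ∀ᵐ ω ∂μ, m ≤ P ω := (ae_mem_essRange hP.1).mono fun _ => hR _
  have hlower : ∀ n,
      HasLowerType m (modularDilation (expMO P) (μ.restrict (N ⁻¹' {n})) g) := fun n =>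
    hasLowerType_modularDilation (ae_restrict_of_ae (hmP.mono fun _ => hasLowerType_powerFn)) g
  have hiff := S.isMusielakOrlicz_iff_orliczOf hm hlower (hasLowerType_orliczOf hm hR hk) one_pos
    (fun n => (hmod n).1) one_pos (s := fun _ => 1) (fun _ => ⟨le_rfl, le_rfl⟩)
    (fun n t => by simpa only [one_mul] using (hmod n).2 t) hsum
  exact (hiff.2 hSk).disjointlyEmbeds hm hmP hN hg

end SequenceSpace

end VarExp

theorem mainTheorem6 {𝕜 : Type*} [RCLike 𝕜] {Ω : Type*} [MeasurableSpace Ω]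
    (μ : Measure Ω) [SigmaFinite μ] (hμ : VarExp.IsNonatomic μ)
    (P : Ω → ℝ≥0∞) (hP : VarExp.IsVarExponent P) (hPpos : 0 < VarExp.expMinus P μ)
    (S : VarExp.SequenceSpace 𝕜) (hS : S.IsSubsymmetric) :
    S.DisjointlyEmbeds μ P ↔
      ∃ F : ℝ≥0 → ℝ≥0∞, VarExp.OrliczGen (VarExp.essRange P μ) F ∧ S.EqOrliczSpace F := by
  obtain ⟨m, hm, hR⟩ := VarExp.exists_pos_forall_coe_le_of_expMinus_pos hPpos
  exact ⟨fun hT => hT.exists_orliczGen hS hm hP hR,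
    fun ⟨_, hF, hSF⟩ => hSF.disjointlyEmbeds hμ hm hP hR hF⟩
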